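/- For a finite simple graph $G$, the cop number $c(G)$ is the minimum $k\ge 1$ such that $k$ cops have a winning strategy in the following game on $G$ with full information. The cops first choose their $k$ vertices (several cops may share a vertex), then the robber chooses a vertex; after that the cops and the robber move alternately, the cops first, each player either moving along an edge or staying put. The cops win if at some point a cop and the robber occupy the same vertex, and the robber wins if she can avoid this indefinitely. Let $\mathcal G(n,p)$ denote the random graph on $n$ labelled vertices in which each pair of vertices is an edge independently with probability $p$. **Theorem.** There is an absolute constant $C>0$ such that the following holds. Let $p=p(n)\in[0,1]$ be such that $d=p(n-1)\ge \log^3 n$ for all sufficiently large $n$ (where $\log$ is the natural logarithm and $\log^3 n=(\log n)^3$). Then, for $G\in\mathcal G(n,p)$, $$\mathbb P\big(c(G)\le C\sqrt n\big)\longrightarrow 1\qquad\text{as } n\to\infty .$$ -/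

import Mathlib

open Filter Topology

namespace CopsAndRobbers

variable {V : Type*}

/-- A move along the graph: a player stays at the current vertex or crosses an edge. -/
def Step (G : SimpleGraph V) (u v : V) : Prop := v = u ∨ G.Adj u v

/-- A (deterministic, full-information) strategy for `k` cops on `G`.
`position h i` is the vertex of the `i`-th cop when `h` is the list of vertices that the robber
has occupied so far (her starting vertex first). So `position []` is the initial placement, which
is chosen before the robber appears, and each time the robber has chosen a vertex the cops
answer with one legal move each. Several cops may share a vertex. -/
structure CopStrategy (G : SimpleGraph V) (k : ℕ) where
  position : List V → Fin k → V
  legal : ∀ (h : List V) (v : V) (i : Fin k), Step G (position h i) (position (h ++ [v]) i)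

/-- A play of the robber: `ρ 0` is her starting vertex and `ρ t` her vertex after `t` moves. -/
def IsRobberPlay (G : SimpleGraph V) (ρ : ℕ → V) : Prop := ∀ t, Step G (ρ t) (ρ (t + 1))

/-- The list `[ρ 0, …, ρ (t - 1)]` of the first `t` vertices of a play of the robber. -/
def history (ρ : ℕ → V) (t : ℕ) : List V := (List.range t).map ρ

/-- At some point a cop and the robber occupy the same vertex: either the robber has just
come to `ρ t`, where some cop stands, or a cop moves onto the robber, who stands at `ρ t`. -/
def CopStrategy.Captures {G : SimpleGraph V} {k : ℕ} (σ : CopStrategy G k) (ρ : ℕ → V) : Prop :=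
  ∃ (t : ℕ) (i : Fin k),
    σ.position (history ρ t) i = ρ t ∨ σ.position (history ρ (t + 1)) i = ρ t

/-- `k` cops win on `G`: they have a strategy against which the robber cannot avoid capture
indefinitely, whatever she does. -/
def CopsWin (G : SimpleGraph V) (k : ℕ) : Prop :=
  ∃ σ : CopStrategy G k, ∀ ρ : ℕ → V, IsRobberPlay G ρ → σ.Captures ρ

/-- The cop number of `G`: the minimum number `k ≥ 1` of cops needed to win on `G`. -/
noncomputable def copNumber (G : SimpleGraph V) : ℕ := sInf {k : ℕ | 1 ≤ k ∧ CopsWin G k}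

/-- A cop on every vertex wins, so on a non-empty finite graph the minimum in `copNumber` is over
a non-empty set. -/
theorem copsWin_card [Fintype V] (G : SimpleGraph V) : CopsWin G (Fintype.card V) :=
  ⟨⟨fun _ i => (Fintype.equivFin V).symm i, fun _ _ _ => Or.inl rfl⟩,
    fun ρ _ => ⟨0, Fintype.equivFin V (ρ 0), Or.inl (by simp)⟩⟩

end CopsAndRobbers

/-! Write d = p(n-1) and L = log n. With high probability every vertex set S grows by a factor close
to d at each step until it fills a constant proportion of the graph
(`measureReal_not_isExpanding_le`), so its r-ball has size of order min(|S| d^r, n) as long as d^r ≤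
n (`card_ball_le`, `min_le_card_ball`). Let r be least with √n < d^(r+1) and place O(√n) cops at
random. In r moves a robber starting at v stays in the r-ball of v, which has O(d^r) = O(√n)
vertices; the cops move first and have r+1 moves to occupy all of it. By Hall's theorem this needs,
for every T in the ball, at least |T| cops within distance r+1 of T. If d^(r+1) ≥ √n L, a first
moment bound over all v and T gives this (`copsWin_of_gap`).

If √n ≤ d^(r+1) < √n L, the union bound fails for small T and Hall's condition is obtained only up
to a deficiency K (`exists_placement_up_to_deficiency`). For r ≥ 1 take K = √n/d: the first team
leaves at most K vertices free, the next robber move from these leads to O(√n) vertices, and a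
second team has r+2 moves to occupy them, the extra step supplying the missing logarithm
(`copsWin_of_window`). For r = 0 this K is at most 1, too small for a union over v. Instead the
first team waits, and catches the robber after her first move unless she enters one of O(√n)
vertices with no such cop nearby; the second team occupies those in two moves
(`copsWin_of_degree_window`). -/

namespace CopsAndRobbers

/-! ### Strategies, balls, and Hall's theorem -/

section Game

variable {V : Type*}

lemma Step.symm {G : SimpleGraph V} {u v : V} (h : Step G u v) : Step G v u := by
  rcases h with h | h
  · exact Or.inl h.symm
  · exact Or.inr h.symm

/-- A strategy of a single cop: a function of the robber's past whose successive values are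
legal moves. -/
def Legal (G : SimpleGraph V) (f : List V → V) : Prop :=
  ∀ (h : List V) (v : V), Step G (f h) (f (h ++ [v]))

/-- Legal individual strategies, one of which always ends up on the robber, win the game. -/
lemma copsWin_of_legal {G : SimpleGraph V} {ι : Type*} [Fintype ι] (f : ι → List V → V)
    (hf : ∀ i, Legal G (f i))
    (hwin : ∀ ρ : ℕ → V, IsRobberPlay G ρ → ∃ t i, f i (history ρ (t + 1)) = ρ t) :
    CopsWin G (Fintype.card ι) := by
  let e := Fintype.equivFin ι
  refine ⟨⟨fun h i => f (e.symm i) h, fun h v i => hf _ h v⟩, fun ρ hρ => ?_⟩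
  obtain ⟨t, i, hi⟩ := hwin ρ hρ
  exact ⟨t, e i, Or.inr (by simpa using hi)⟩

/-- A cop who waits until the robber has made her first move and catches her if he can. -/
lemma exists_legal_wait (G : SimpleGraph V) (a : V) :
    ∃ f : List V → V, Legal G f ∧
      ∀ ρ : ℕ → V, Step G a (ρ 1) → f (history ρ 2) = ρ 1 := by
  classical
  refine ⟨fun l => match l with
    | _ :: w :: _ => if Step G a w then w else a
    | _ => a, ?_, ?_⟩
  · intro l v
    match l with
    | [] => exact Or.inl rfl
    | [w] =>
      simp only [List.cons_append, List.nil_append]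
      split_ifs with h
      · exact h
      · exact Or.inl rfl
    | _ :: w :: l => exact Or.inl rfl
  · intro ρ h
    simp [history, List.range_succ, h]

variable [Fintype V]

open Classical in
/-- The closed neighbourhood of a set of vertices. -/
noncomputable def closedNbr (G : SimpleGraph V) (S : Finset V) : Finset V :=
  Finset.univ.filter fun w => ∃ u ∈ S, Step G u w

/-- The vertices at distance at most `r` from `S`. -/
noncomputable def ball (G : SimpleGraph V) (r : ℕ) (S : Finset V) : Finset V :=
  (closedNbr G)^[r] S

lemma mem_closedNbr {G : SimpleGraph V} {S : Finset V} {w : V} :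
    w ∈ closedNbr G S ↔ ∃ u ∈ S, Step G u w := by
  simp [closedNbr]

lemma ball_zero (G : SimpleGraph V) (S : Finset V) : ball G 0 S = S := rfl

lemma ball_succ (G : SimpleGraph V) (r : ℕ) (S : Finset V) :
    ball G (r + 1) S = closedNbr G (ball G r S) := by
  simp [ball, Function.iterate_succ_apply']

lemma subset_closedNbr (G : SimpleGraph V) (S : Finset V) : S ⊆ closedNbr G S :=
  fun u hu => mem_closedNbr.2 ⟨u, hu, Or.inl rfl⟩

lemma closedNbr_mono (G : SimpleGraph V) {S T : Finset V} (h : S ⊆ T) :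
    closedNbr G S ⊆ closedNbr G T := by
  intro w hw
  obtain ⟨u, hu, hs⟩ := mem_closedNbr.1 hw
  exact mem_closedNbr.2 ⟨u, h hu, hs⟩

lemma ball_mono (G : SimpleGraph V) (r : ℕ) {S T : Finset V} (h : S ⊆ T) :
    ball G r S ⊆ ball G r T := by
  induction r with
  | zero => exact h
  | succ r ih => simpa only [ball_succ] using closedNbr_mono G ih

lemma mem_ball_iff_exists {G : SimpleGraph V} {r : ℕ} {S : Finset V} {w : V} :
    w ∈ ball G r S ↔ ∃ u ∈ S, w ∈ ball G r {u} := by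
  induction r generalizing w with
  | zero => simp [ball_zero]
  | succ r ih =>
    simp only [ball_succ, mem_closedNbr]
    constructor
    · rintro ⟨x, hx, hs⟩
      obtain ⟨u, hu, hxu⟩ := ih.1 hx
      exact ⟨u, hu, x, hxu, hs⟩
    · rintro ⟨u, hu, x, hxu, hs⟩
      exact ⟨x, ih.2 ⟨u, hu, hxu⟩, hs⟩

lemma play_mem_ball {G : SimpleGraph V} {ρ : ℕ → V} (hρ : IsRobberPlay G ρ) (r : ℕ) :
    ρ r ∈ ball G r {ρ 0} := by
  induction r with
  | zero => simp [ball_zero]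
  | succ r ih => rw [ball_succ]; exact mem_closedNbr.2 ⟨_, ih, hρ r⟩

/-- Steps are symmetric, so a walk out of u can be run backwards. It is extended to all times so
that a cop following it still moves legally after arrival. -/
lemma exists_path_of_mem_ball {G : SimpleGraph V} {r : ℕ} {u w : V} (h : w ∈ ball G r {u}) :
    ∃ π : ℕ → V, π 0 = w ∧ π r = u ∧ ∀ t, Step G (π t) (π (t + 1)) := by
  induction r generalizing w with
  | zero =>
    refine ⟨fun _ => w, rfl, ?_, fun _ => Or.inl rfl⟩
    simpa [ball_zero] using h
  | succ r ih =>
    rw [ball_succ] at h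
    obtain ⟨x, hx, hs⟩ := mem_closedNbr.1 h
    obtain ⟨π, h0, hr, hπ⟩ := ih hx
    refine ⟨fun t => Nat.casesOn t w π, rfl, hr, fun t => ?_⟩
    cases t with
    | zero =>
      change Step G w (π 0)
      exact h0.symm ▸ hs.symm
    | succ t => exact hπ t

/-- A cop at `a` can, in `R` moves, reach a target that depends on the first robber position. -/
lemma exists_legal_goto {G : SimpleGraph V} {R : ℕ} {a : V} {τ : V → V}
    (h : ∀ v, a ∈ ball G R {τ v}) :
    ∃ f : List V → V, Legal G f ∧ ∀ ρ : ℕ → V, f (history ρ R) = τ (ρ 0) ∨ R = 0 := by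
  choose π h0 hR hπ using fun v => exists_path_of_mem_ball (h v)
  refine ⟨fun l => match l with
    | [] => a
    | v :: l => π v (l.length + 1), ?_, ?_⟩
  · intro l v
    cases l with
    | nil => simpa [h0] using hπ v 0
    | cons w l => simpa using hπ w (l.length + 1)
  · intro ρ
    cases R with
    -- With no move made the cop has not yet seen `ρ 0`.
    | zero => exact Or.inr rfl
    | succ R =>
      left
      have : history ρ (R + 1) = ρ 0 :: (List.range R).map (fun i => ρ (i + 1)) := by
        simp [history, List.range_succ_eq_map, Function.comp_def]
      rw [this]
      simpa using hR (ρ 0)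

/-- The cops starting at `a` can occupy all of `B` simultaneously after `R` moves. -/
def Guards (G : SimpleGraph V) {ι : Type*} (R : ℕ) (a : ι → V) (B : Finset V) : Prop :=
  ∃ f : V → ι, Set.InjOn f B ∧ ∀ u ∈ B, a (f u) ∈ ball G R {u}

lemma subset_ball (G : SimpleGraph V) (r : ℕ) (S : Finset V) : S ⊆ ball G r S := by
  induction r with
  | zero => exact subset_rfl
  | succ r ih => rw [ball_succ]; exact ih.trans (subset_closedNbr _ _)

/-- Each cop heads for the vertex assigned to it, unique by injectivity, or stays at `a i` if there
is none. The assignment may depend on the robber's start, the placement may not. -/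
lemma Guards.exists_legal {G : SimpleGraph V} {ι : Type*} {R : ℕ} {a : ι → V}
    {B : V → Finset V} (h : ∀ v, Guards G (R + 1) a (B v)) :
    ∃ f : ι → List V → V, (∀ i, Legal G (f i)) ∧
      ∀ ρ : ℕ → V, ∀ u ∈ B (ρ 0), ∃ i, f i (history ρ (R + 1)) = u := by
  classical
  choose g hinj hg using h
  let τ : ι → V → V := fun i v => if h : ∃ u ∈ B v, g v u = i then h.choose else a i
  have hτ : ∀ i v, a i ∈ ball G (R + 1) {τ i v} := by
    intro i v
    by_cases h : ∃ u ∈ B v, g v u = i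
    · simp only [τ, dif_pos h]
      have := hg v _ h.choose_spec.1
      rwa [h.choose_spec.2] at this
    · simp only [τ, dif_neg h]
      exact subset_ball _ _ _ (Finset.mem_singleton_self _)
  choose f hf hf' using fun i => exists_legal_goto (hτ i)
  refine ⟨f, hf, fun ρ u hu => ⟨g (ρ 0) u, ?_⟩⟩
  have h1 := (hf' (g (ρ 0) u) ρ).resolve_right (by simp)
  rw [h1]
  have h : ∃ u' ∈ B (ρ 0), g (ρ 0) u' = g (ρ 0) u := ⟨u, hu, rfl⟩
  simp only [τ, dif_pos h]
  exact hinj (ρ 0) h.choose_spec.1 hu h.choose_spec.2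

/-- One team occupies every vertex which the robber can reach in `r` moves. -/
lemma copsWin_of_guards_ball {G : SimpleGraph V} {k r : ℕ} {a : Fin k → V}
    (h : ∀ v, Guards G (r + 1) a (ball G r {v})) : CopsWin G k := by
  obtain ⟨f, hf, hcap⟩ := Guards.exists_legal h
  -- `history ρ (r + 1)` ends with `ρ r`: the cops have made r+1 moves when the robber has made r.
  have := copsWin_of_legal f hf fun ρ hρ => ⟨r, hcap ρ _ (play_mem_ball hρ r)⟩
  simpa using this

/-- The first team leaves only `U v` free after `r` moves of the robber, the second team occupies
everything that she can reach from there with one more move. -/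
lemma copsWin_of_two_teams {G : SimpleGraph V} {k₁ k₂ r : ℕ} {a₁ : Fin k₁ → V} {a₂ : Fin k₂ → V}
    (U : V → Finset V)
    (h₁ : ∀ v, ∃ B, Guards G (r + 1) a₁ B ∧ ∀ u ∈ ball G r {v}, u ∈ B ∨ u ∈ U v)
    (h₂ : ∀ v, Guards G (r + 2) a₂ (closedNbr G (U v))) : CopsWin G (k₁ + k₂) := by
  classical
  choose B hB hBU using h₁
  obtain ⟨f₁, hf₁, hc₁⟩ := Guards.exists_legal hB
  obtain ⟨f₂, hf₂, hc₂⟩ := Guards.exists_legal h₂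
  have := copsWin_of_legal (G := G) (ι := Fin k₁ ⊕ Fin k₂) (Sum.elim f₁ f₂)
    (by rintro (i | i) <;> simp [hf₁, hf₂]) ?_
  · simpa using this
  intro ρ hρ
  rcases hBU (ρ 0) _ (play_mem_ball hρ r) with h | h
  · obtain ⟨i, hi⟩ := hc₁ ρ _ h
    exact ⟨r, Sum.inl i, hi⟩
  · obtain ⟨i, hi⟩ := hc₂ ρ _ (mem_closedNbr.2 ⟨_, h, hρ r⟩)
    exact ⟨r + 1, Sum.inr i, hi⟩

/-- The first team waits, the second team occupies what the first leaves free. -/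
lemma copsWin_of_waiting_team {G : SimpleGraph V} {k₁ k₂ : ℕ} {a₁ : Fin k₁ → V}
    {a₂ : Fin k₂ → V} (Z : V → Finset V)
    (h₁ : ∀ v, ∀ u ∈ closedNbr G {v}, u ∉ Z v → ∃ i, a₁ i ∈ closedNbr G {u})
    (h₂ : ∀ v, Guards G 2 a₂ (Z v)) : CopsWin G (k₁ + k₂) := by
  classical
  choose f₁ hf₁ hc₁ using fun i => exists_legal_wait G (a₁ i)
  obtain ⟨f₂, hf₂, hc₂⟩ := Guards.exists_legal h₂
  have := copsWin_of_legal (G := G) (ι := Fin k₁ ⊕ Fin k₂) (Sum.elim f₁ f₂)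
    (by rintro (i | i) <;> simp [hf₁, hf₂]) ?_
  · simpa using this
  intro ρ hρ
  by_cases h : ρ 1 ∈ Z (ρ 0)
  · obtain ⟨i, hi⟩ := hc₂ ρ _ h
    exact ⟨1, Sum.inr i, hi⟩
  · obtain ⟨i, hi⟩ := h₁ (ρ 0) (ρ 1) (play_mem_ball hρ 1) h
    refine ⟨1, Sum.inl i, hc₁ i ρ ?_⟩
    obtain ⟨x, hx, hs⟩ := mem_closedNbr.1 hi
    rw [Finset.mem_singleton] at hx
    exact hx ▸ hs.symm

open Classical in
/-- Hall's theorem with deficiency `K`: the cops can guard all but `K` vertices of `B`. -/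
lemma exists_guards_of_deficiency {G : SimpleGraph V} {k R K : ℕ} (hk : 0 < k) {a : Fin k → V}
    {B : Finset V}
    (h : ∀ T ⊆ B, T.card ≤ (Finset.univ.filter fun i => a i ∈ ball G R T).card + K) :
    ∃ U W : Finset V, U.card ≤ K ∧ Guards G R a W ∧ ∀ u ∈ B, u ∈ W ∨ u ∈ U := by
  -- `K` dummy cops, admissible for every vertex, turn the deficient condition into Hall's; `U` will
  -- consist of the vertices matched to dummies.
  let t : B → Finset (Fin k ⊕ Fin K) := fun u =>
    (Finset.univ.filter fun i => a i ∈ ball G R {u.1}).disjSum Finset.univ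
  have hall : ∀ s : Finset B, s.card ≤ (s.biUnion t).card := by
    intro s
    rcases s.eq_empty_or_nonempty with rfl | hs
    · simp
    have hsub : ((Finset.univ.filter fun i => a i ∈ ball G R (s.map (.subtype _))).disjSum
        (Finset.univ : Finset (Fin K))) ⊆ s.biUnion t := by
      intro x hx
      obtain ⟨u₀, hu₀⟩ := hs
      rcases x with i | j
      · simp only [Finset.inl_mem_disjSum, Finset.mem_filter, Finset.mem_univ, true_and] at hx
        obtain ⟨u, hu, hi⟩ := mem_ball_iff_exists.1 hx
        obtain ⟨u', hu', rfl⟩ := Finset.mem_map.1 hu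
        exact Finset.mem_biUnion.2 ⟨u', hu', by simpa [t] using hi⟩
      · exact Finset.mem_biUnion.2 ⟨u₀, hu₀, by simp [t]⟩
    have h1 := h (s.map (.subtype _)) (by
      intro x hx
      obtain ⟨u', -, rfl⟩ := Finset.mem_map.1 hx
      exact u'.2)
    have h2 := Finset.card_le_card hsub
    rw [Finset.card_disjSum, Finset.card_univ, Fintype.card_fin] at h2
    rw [Finset.card_map] at h1
    exact h1.trans h2
  obtain ⟨f, hinj, hf⟩ := (Finset.all_card_le_biUnion_card_iff_exists_injective t).1 hall
  let g : V → Fin k := fun u =>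
    if hu : u ∈ B then Sum.elim id (fun _ => ⟨0, hk⟩) (f ⟨u, hu⟩) else ⟨0, hk⟩
  let emb : B ↪ V := .subtype _
  refine ⟨(Finset.univ.filter fun u => (f u).isRight).map emb,
    (Finset.univ.filter fun u => (f u).isLeft).map emb, ?_, ⟨g, ?_, ?_⟩, ?_⟩
  · rw [Finset.card_map]
    have : ((Finset.univ.filter fun u : B => (f u).isRight).image f).card ≤
        (Finset.univ.map (⟨Sum.inr, Sum.inr_injective⟩ : Fin K ↪ Fin k ⊕ Fin K)).card := by
      apply Finset.card_le_card
      intro x hx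
      obtain ⟨u, hu, rfl⟩ := Finset.mem_image.1 hx
      obtain ⟨j, hj⟩ := Sum.isRight_iff.1 (Finset.mem_filter.1 hu).2
      simp [hj]
    rw [Finset.card_image_of_injective _ hinj] at this
    simpa using this
  · intro u hu w hw huw
    obtain ⟨u, hu', rfl⟩ := Finset.mem_map.1 (Finset.mem_coe.1 hu)
    obtain ⟨w, hw', rfl⟩ := Finset.mem_map.1 (Finset.mem_coe.1 hw)
    obtain ⟨i, hi⟩ := Sum.isLeft_iff.1 (Finset.mem_filter.1 hu').2
    obtain ⟨j, hj⟩ := Sum.isLeft_iff.1 (Finset.mem_filter.1 hw').2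
    have : i = j := by simpa [g, emb, hi, hj] using huw
    exact congrArg emb (hinj (hi.trans (this ▸ hj.symm)))
  · intro u hu
    obtain ⟨u, hu', rfl⟩ := Finset.mem_map.1 hu
    obtain ⟨i, hi⟩ := Sum.isLeft_iff.1 (Finset.mem_filter.1 hu').2
    have h1 := hf u
    rw [hi] at h1
    simpa [g, emb, hi, t] using h1
  · intro u hu
    rcases hfu : f ⟨u, hu⟩ with i | j
    · left; simp [emb, hu, hfu]
    · right; simp [emb, hu, hfu]

end Game

/-! ### Random placement of the cops -/

section Placement

variable {V : Type*}

/-- The sum equals (1+z)^|B|. This handles union bounds over subsets without binomial coefficients.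
-/
lemma sum_powerset_pow_card_le (B : Finset V) {z : ℝ} (hz : 0 ≤ z) :
    ∑ T ∈ B.powerset, z ^ T.card ≤ Real.exp (z * B.card) := by
  have h := Finset.sum_pow_mul_eq_add_pow z 1 B
  simp only [one_pow, mul_one] at h
  rw [h, mul_comm, Real.exp_nat_mul]
  exact pow_le_pow_left₀ (by linarith) (Real.add_one_le_exp z) _

open Classical in
-- The base is n⁻³, so the sum is at most exp(n⁻²) - 1.
lemma sum_powerset_erase_pow_card_le (B : Finset V) {n : ℝ} (hn : 1 ≤ n) (hB : B.card ≤ n) :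
    ∑ T ∈ B.powerset.erase ∅, Real.exp (-(3 * Real.log n)) ^ T.card ≤ 2 * (n ^ 2)⁻¹ := by
  have hn0 : 0 < n := by linarith
  set z : ℝ := Real.exp (-(3 * Real.log n)) with hz
  have hzn : z * n = (n ^ 2)⁻¹ := by
    have : z = (n ^ 3)⁻¹ := by
      rw [hz, Real.exp_neg, show 3 * Real.log n = ((3 : ℕ) : ℝ) * Real.log n by norm_num,
        Real.exp_nat_mul, Real.exp_log hn0]
    rw [this]; field_simp
  have h1 := sum_powerset_pow_card_le B (Real.exp_pos (-(3 * Real.log n))).le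
  rw [← Finset.add_sum_erase _ _ (Finset.empty_mem_powerset B)] at h1
  have h2 : Real.exp (z * B.card) ≤ Real.exp (z * n) :=
    Real.exp_le_exp.2 (mul_le_mul_of_nonneg_left hB (Real.exp_pos _).le)
  have h3 : (n ^ 2)⁻¹ ≤ 1 := inv_le_one_of_one_le₀ (by nlinarith)
  have h4 : 0 ≤ (n ^ 2)⁻¹ := by positivity
  have h5 := (abs_le.1 (Real.abs_exp_sub_one_sub_id_le (x := (n ^ 2)⁻¹)
    (by rwa [abs_of_nonneg h4]))).2
  rw [hzn] at h2
  simp only [Finset.card_empty, pow_zero] at h1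
  nlinarith

variable [Fintype V]

open Classical in
/-- First moment method for cops placed independently and uniformly at random. -/
lemma exists_placement [Nonempty V] {k : ℕ} {I : Type*} (s : Finset I) (N : I → Finset V)
    (m : I → ℝ)
    (h : ∑ i ∈ s, Real.exp (m i - k * (N i).card / (2 * Fintype.card V)) < 1) :
    ∃ a : Fin k → V, ∀ i ∈ s, m i < (Finset.univ.filter fun j => a j ∈ N i).card := by
  by_contra! hcon
  set n : ℝ := (Fintype.card V : ℝ) with hn
  have hn0 : 0 < n := by rw [hn]; exact_mod_cast Fintype.card_pos
  -- The weight exp(-#cops in `N i`) is a product over cops, so its sum over all placements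
  -- factorises; 1 - 1/e ≥ 1/2 produces the 2 in the exponent.
  let w : I → V → ℝ := fun i v => if v ∈ N i then Real.exp (-1) else 1
  have hw : ∀ i, ∑ a : Fin k → V, ∏ j, w i (a j) ≤
      n ^ k * Real.exp (-(k * (N i).card / (2 * n))) := by
    intro i
    rw [← Fintype.sum_pow]
    have h1 : ∑ v, w i v ≤ n * Real.exp (-((N i).card / (2 * n))) := by
      have h2 : ∑ v, w i v = n - (N i).card * (1 - Real.exp (-1)) := by
        have : ∀ v, w i v = 1 - if v ∈ N i then (1 - Real.exp (-1)) else 0 := by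
          intro v; simp only [w]; split_ifs <;> ring
        simp only [this, Finset.sum_sub_distrib, Finset.sum_ite_mem, Finset.univ_inter,
          Finset.sum_const, Finset.card_univ, nsmul_eq_mul, mul_one, ← hn]
        ring
      have h3 : Real.exp (-1) ≤ 1 / 2 := by
        rw [Real.exp_neg, ← one_div]
        exact one_div_le_one_div_of_le (by norm_num) (by linarith [Real.add_one_le_exp (1 : ℝ)])
      have h4 := Real.add_one_le_exp (-((N i).card / (2 * n)))
      have h5 : n * (-((N i).card / (2 * n)) + 1) = n - (N i).card / 2 := by
        field_simp; ring
      have h6 : (0 : ℝ) ≤ (N i).card := by positivity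
      nlinarith [mul_le_mul_of_nonneg_left h4 hn0.le]
    calc (∑ v, w i v) ^ k ≤ (n * Real.exp (-((N i).card / (2 * n)))) ^ k := by
          apply pow_le_pow_left₀ _ h1
          exact Finset.sum_nonneg fun v _ => by simp only [w]; split_ifs <;> positivity
      _ = _ := by
          rw [mul_pow, ← Real.exp_nat_mul]
          congr 2; ring
  have hprod : ∀ i (a : Fin k → V),
      ∏ j, w i (a j) = Real.exp (-((Finset.univ.filter fun j => a j ∈ N i).card : ℝ)) := by
    intro i a
    simp only [w, Finset.prod_ite, Finset.prod_const, one_pow, mul_one]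
    rw [← Real.exp_nat_mul]; congr 1; ring
  -- A placement failing at i makes the i-th term at least 1.
  have h1 : ∀ a : Fin k → V, 1 ≤ ∑ i ∈ s, Real.exp (m i) * ∏ j, w i (a j) := by
    intro a
    obtain ⟨i, hi, hle⟩ := hcon a
    refine le_trans ?_ (Finset.single_le_sum (f := fun i => Real.exp (m i) * ∏ j, w i (a j))
      (fun i _ => ?_) hi)
    · simp only [hprod, ← Real.exp_add]
      exact Real.one_le_exp (by linarith)
    · simp only [hprod]; positivity
  have h2 : n ^ k ≤ ∑ a : Fin k → V, ∑ i ∈ s, Real.exp (m i) * ∏ j, w i (a j) := by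
    refine le_trans ?_ (Finset.sum_le_sum fun a _ => h1 a)
    simp [hn]
  rw [Finset.sum_comm] at h2
  have h3 : ∑ i ∈ s, ∑ a : Fin k → V, Real.exp (m i) * ∏ j, w i (a j) ≤
      n ^ k * ∑ i ∈ s, Real.exp (m i - k * (N i).card / (2 * n)) := by
    rw [Finset.mul_sum]
    refine Finset.sum_le_sum fun i _ => ?_
    rw [← Finset.mul_sum, sub_eq_add_neg, Real.exp_add]
    calc _ ≤ Real.exp (m i) * (n ^ k * Real.exp (-(k * (N i).card / (2 * n)))) :=
          mul_le_mul_of_nonneg_left (hw i) (Real.exp_pos _).le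
      _ = _ := by ring
  have h4 : (0 : ℝ) < n ^ k := by positivity
  nlinarith

open Classical in
/-- Cops that are placed at random miss at most `K` vertices in Hall's condition. -/
lemma exists_placement_up_to_deficiency [Nonempty V] {M c : ℝ} (hM : 1 ≤ M) (hc : 0 < c)
    {J : Type*} [Fintype J] {k : ℕ} {x K : ℝ} (hx : 1 ≤ x) (hK : 0 ≤ K)
    (hk : 2 * (4 + M) / c * √(Fintype.card V) ≤ k) (B : J → Finset V)
    (N : Finset V → Finset V) (hB : ∀ j, ((B j).card : ℝ) ≤ M * x * K)
    (hN : ∀ j, ∀ T ⊆ B j, c * T.card * x * √(Fintype.card V) ≤ (N T).card)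
    (hJ : Fintype.card J < Real.exp K) :
    ∃ a : Fin k → V, ∀ j, ∀ T ⊆ B j,
      (T.card : ℝ) ≤ (Finset.univ.filter fun i => a i ∈ N T).card + K := by
  set n : ℝ := (Fintype.card V : ℝ) with hn
  have hn0 : 0 < n := by rw [hn]; exact_mod_cast Fintype.card_pos
  -- In 3 = 1 + 2, the 1 is the |T| of the first moment term and the 2 pays for the factor exp(-2K),
  -- available because |T| ≥ K.
  let z : ℝ := Real.exp (3 - (4 + M) * x)
  have hz : z * (M * x) ≤ 1 := by
    have h1 : M ≤ Real.exp (M * x) :=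
      le_trans (by nlinarith) ((by linarith [Real.add_one_le_exp (M * x)] :
        M * x ≤ Real.exp (M * x)))
    have h2 : x ≤ Real.exp x := by linarith [Real.add_one_le_exp x]
    calc z * (M * x) ≤ z * (Real.exp (M * x) * Real.exp x) := by
          have := mul_le_mul h1 h2 (by linarith) (Real.exp_pos _).le
          exact mul_le_mul_of_nonneg_left this (Real.exp_pos _).le
      _ = Real.exp (3 - 3 * x) := by
          simp only [z, ← Real.exp_add]; congr 1; ring
      _ ≤ 1 := Real.exp_le_one_iff.2 (by linarith)
  -- Sets smaller than `K` satisfy the conclusion trivially and stay out of the union bound.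
  let s : Finset (Σ _ : J, Finset V) :=
    Finset.univ.sigma fun j => (B j).powerset.filter fun T => K ≤ T.card
  have hterm : ∀ j, ∀ T ⊆ B j, K ≤ T.card →
      Real.exp (T.card - k * (N T).card / (2 * n)) ≤ Real.exp (-(2 * K)) * z ^ T.card := by
    intro j T hT hKT
    have h1 : (4 + M) * T.card * x ≤ k * (N T).card / (2 * n) := by
      rw [le_div_iff₀ (by positivity)]
      have h2 := mul_le_mul hk (hN j T hT) (by positivity) (by positivity)
      refine le_trans (le_of_eq ?_) h2
      have h3 : √n * √n = n := Real.mul_self_sqrt hn0.le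
      field_simp
      rw [sq, h3]
    rw [← Real.exp_nat_mul, ← Real.exp_add]
    apply Real.exp_le_exp.2
    linarith
  obtain ⟨a, ha⟩ := exists_placement (k := k) s (fun i => N i.2) (fun i => i.2.card) (by
    rw [Finset.sum_sigma]
    calc _ ≤ ∑ j : J, Real.exp (-(2 * K)) * Real.exp K := by
          refine Finset.sum_le_sum fun j _ => ?_
          calc _ ≤ ∑ T ∈ (B j).powerset.filter (fun T => K ≤ T.card),
                Real.exp (-(2 * K)) * z ^ T.card := by
                refine Finset.sum_le_sum fun T hT => ?_
                obtain ⟨h1, h2⟩ := Finset.mem_filter.1 hT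
                exact hterm j T (Finset.mem_powerset.1 h1) h2
            _ ≤ ∑ T ∈ (B j).powerset, Real.exp (-(2 * K)) * z ^ T.card :=
                Finset.sum_le_sum_of_subset_of_nonneg (Finset.filter_subset _ _)
                  fun _ _ _ => by positivity
            _ ≤ Real.exp (-(2 * K)) * Real.exp K := by
                rw [← Finset.mul_sum]
                refine mul_le_mul_of_nonneg_left ?_ (Real.exp_pos _).le
                refine (sum_powerset_pow_card_le _ (Real.exp_pos _).le).trans
                  (Real.exp_le_exp.2 ?_)
                calc z * (B j).card ≤ z * (M * x * K) :=
                      mul_le_mul_of_nonneg_left (hB j) (Real.exp_pos _).le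
                  _ = (z * (M * x)) * K := by ring
                  _ ≤ 1 * K := mul_le_mul_of_nonneg_right hz hK
                  _ = K := one_mul K
      _ = Fintype.card J * Real.exp (-K) := by
          rw [Finset.sum_const, Finset.card_univ, nsmul_eq_mul, ← Real.exp_add]
          congr 2; ring
      _ < Real.exp K * Real.exp (-K) := mul_lt_mul_of_pos_right hJ (Real.exp_pos _)
      _ = 1 := by rw [← Real.exp_add]; simp)
  refine ⟨a, fun j T hT => ?_⟩
  by_cases hKT : K ≤ T.card
  · have := ha ⟨j, T⟩ (by simp [s, hT, hKT])
    simp only at this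
    linarith
  · have : (0 : ℝ) ≤ (Finset.univ.filter fun i => a i ∈ N T).card := by positivity
    linarith [not_le.1 hKT]

open Classical in
/-- Cops that are placed at random satisfy Hall's condition. -/
lemma exists_placement_hall {M c : ℝ} (hM : 0 ≤ M) (hc : 0 < c)
    {J : Type*} [Fintype J] {k : ℕ} (hV : 4 ≤ Fintype.card V)
    (hk : 2 * (4 + 2 * M) / c * √(Fintype.card V) ≤ k) (Z : J → Finset V)
    (N : Finset V → Finset V) (hZ : ∀ j, ((Z j).card : ℝ) ≤ M * √(Fintype.card V))
    (hN : ∀ j, ∀ S ⊆ Z j, S.Nonempty →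
      c * min (S.card * √(Fintype.card V) * Real.log (Fintype.card V)) (Fintype.card V) ≤
        (N S).card)
    (hJ : Fintype.card J ≤ Fintype.card V) :
    ∃ a : Fin k → V, ∀ j, ∀ S ⊆ Z j,
      S.card ≤ (Finset.univ.filter fun i => a i ∈ N S).card := by
  have : Nonempty V := Fintype.card_pos_iff.1 (by omega)
  set n : ℝ := (Fintype.card V : ℝ) with hn
  have hn4 : 4 ≤ n := by rw [hn]; exact_mod_cast hV
  have hn0 : 0 < n := by linarith
  set L := Real.log n with hL
  have hL1 : 1 ≤ L := by
    rw [hL, Real.le_log_iff_exp_le hn0]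
    linarith [Real.exp_one_lt_d9]
  have hsq : √n * √n = n := Real.mul_self_sqrt hn0.le
  have hsq0 : 0 < √n := Real.sqrt_pos.2 hn0
  -- A set with |S| L ≤ √n contributes at most n^(-3|S|); any other contributes at most `q`, and
  -- there are at most exp(M√n) of those.
  let z : ℝ := Real.exp (-(3 * L))
  let q : ℝ := Real.exp ((M - (4 + 2 * M)) * √n)
  let s : Finset (Σ _ : J, Finset V) :=
    Finset.univ.sigma fun j => (Z j).powerset.erase ∅
  have hterm : ∀ j, ∀ S ⊆ Z j, S.Nonempty →
      Real.exp (S.card - k * (N S).card / (2 * n)) ≤ z ^ S.card + q := by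
    intro j S hS hne
    have h1 : (4 + 2 * M) * min (S.card * L) √n ≤ k * (N S).card / (2 * n) := by
      rw [le_div_iff₀ (by positivity)]
      have h2 := mul_le_mul hk (hN j S hS hne) (by positivity) (by positivity)
      refine le_trans (le_of_eq ?_) h2
      have h3 : min (S.card * √n * L) n = √n * min (S.card * L) √n := by
        rw [mul_min_of_nonneg _ _ hsq0.le, hsq]; congr 1; ring
      rw [h3]
      field_simp
      rw [sq, hsq]
    have hScard : (S.card : ℝ) ≤ M * √n :=
      le_trans (by exact_mod_cast Finset.card_le_card hS) (hZ j)
    rcases le_total ((S.card : ℝ) * L) √n with h | h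
    · rw [min_eq_left h] at h1
      have : Real.exp (S.card - k * (N S).card / (2 * n)) ≤ z ^ S.card := by
        simp only [z]
        rw [← Real.exp_nat_mul]
        apply Real.exp_le_exp.2
        have h5 : (0 : ℝ) ≤ S.card := by positivity
        have h6 : (0 : ℝ) ≤ M * (S.card * L) := by positivity
        nlinarith
      have : 0 ≤ q := (Real.exp_pos _).le
      linarith
    · rw [min_eq_right h] at h1
      have : Real.exp (S.card - k * (N S).card / (2 * n)) ≤ q :=
        Real.exp_le_exp.2 (by linarith)
      have : 0 ≤ z ^ S.card := by positivity
      linarith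
  have hq : Real.exp (M * √n) * q ≤ (8 * n)⁻¹ := by
    simp only [q]
    rw [← Real.exp_add, show M * √n + (M - (4 + 2 * M)) * √n = -(4 * √n) by ring, Real.exp_neg]
    apply inv_anti₀ (by positivity)
    have := Real.quadratic_le_exp_of_nonneg (x := 4 * √n) (by positivity)
    nlinarith
  obtain ⟨a, ha⟩ := exists_placement (k := k) s (fun i => N i.2) (fun i => i.2.card) (by
    rw [Finset.sum_sigma]
    calc _ ≤ ∑ j : J, (2 * (n ^ 2)⁻¹ + (8 * n)⁻¹) := by
          refine Finset.sum_le_sum fun j _ => ?_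
          calc _ ≤ ∑ T ∈ (Z j).powerset.erase ∅, (z ^ T.card + q) := by
                refine Finset.sum_le_sum fun T hT => ?_
                obtain ⟨h1, h2⟩ := Finset.mem_erase.1 hT
                exact hterm j T (Finset.mem_powerset.1 h2) (Finset.nonempty_iff_ne_empty.2 h1)
            _ ≤ 2 * (n ^ 2)⁻¹ + (8 * n)⁻¹ := by
                rw [Finset.sum_add_distrib]
                apply add_le_add
                · refine sum_powerset_erase_pow_card_le (Z j) (by linarith) ?_
                  rw [hn]; exact_mod_cast Finset.card_le_univ _
                · rw [Finset.sum_const, nsmul_eq_mul]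
                  refine le_trans (mul_le_mul_of_nonneg_right ?_ (Real.exp_pos _).le) hq
                  calc (((Z j).powerset.erase ∅).card : ℝ) ≤ ((Z j).powerset.card : ℝ) := by
                        exact_mod_cast Finset.card_le_card (Finset.erase_subset _ _)
                    _ = (2 : ℝ) ^ (Z j).card := by rw [Finset.card_powerset]; norm_num
                    _ ≤ (Real.exp 1) ^ (Z j).card :=
                        pow_le_pow_left₀ (by norm_num)
                          (by linarith [Real.add_one_le_exp (1 : ℝ)]) _
                    _ = Real.exp (Z j).card := by rw [← Real.exp_nat_mul, mul_one]
                    _ ≤ _ := Real.exp_le_exp.2 (hZ j)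
      _ = Fintype.card J * (2 * (n ^ 2)⁻¹ + (8 * n)⁻¹) := by
          rw [Finset.sum_const, Finset.card_univ, nsmul_eq_mul]
      _ ≤ n * (2 * (n ^ 2)⁻¹ + (8 * n)⁻¹) := by
          refine mul_le_mul_of_nonneg_right ?_ (by positivity)
          rw [hn]; exact_mod_cast hJ
      _ = 2 / n + 1 / 8 := by field_simp
      _ < 1 := by
          have : 2 / n ≤ 1 / 2 := by rw [div_le_div_iff₀ hn0 (by norm_num)]; linarith
          linarith)
  refine ⟨a, fun j S hS => ?_⟩
  rcases S.eq_empty_or_nonempty with rfl | hne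
  · simp
  · have := ha ⟨j, S⟩ (by simp [s, hS, hne.ne_empty])
    exact_mod_cast this.le

end Placement

/-! ### Growth of balls in expanding graphs -/

section Expansion

/-- (1 + y + y²/2)(1 - y + y²/2) = 1 + y⁴/4 ≥ 1. -/
lemma exp_neg_le_quadratic {y : ℝ} (hy : 0 ≤ y) : Real.exp (-y) ≤ 1 - y + y ^ 2 / 2 := by
  have h : Real.exp (-y) ≤ (1 + y + y ^ 2 / 2)⁻¹ := by
    rw [Real.exp_neg]
    exact inv_anti₀ (by positivity) (Real.quadratic_le_exp_of_nonneg hy)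
  refine h.trans ?_
  rw [inv_le_iff_one_le_mul₀ (by positivity)]
  nlinarith [sq_nonneg (y ^ 2)]

/-- The range of parameters considered: `p` is a probability, and the average degree is at least
`log³ n`, where `n` is large. -/
structure IsDense (n : ℕ) (p : ℝ) : Prop where
  nonneg : 0 ≤ p
  le_one : p ≤ 1
  le_log : 2 * (5 + 2 * Real.exp 5) ≤ Real.log n
  le_deg : Real.log n ^ 3 ≤ p * (n - 1)
  log_pow_le : Real.exp 10 * Real.log n ^ 10 ≤ n

namespace IsDense

variable {n : ℕ} {p : ℝ} (h : IsDense n p)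
include h

lemma twenty_le_log : 20 ≤ Real.log n := by
  have := h.le_log
  have := Real.add_one_le_exp (5 : ℝ)
  linarith

lemma log_lt : Real.log n + 1 ≤ n := by
  have hn : (0 : ℝ) < n := by
    rcases Nat.eq_zero_or_pos n with rfl | hn
    · have := h.twenty_le_log
      simp at this
      linarith
    · exact_mod_cast hn
  linarith [Real.log_le_sub_one_of_pos hn]

lemma log_le_deg : Real.log n ≤ p * (n - 1) := by
  have := h.twenty_le_log
  refine le_trans ?_ h.le_deg
  nlinarith [sq_nonneg (Real.log n)]

lemma deg_le : p * (n - 1) ≤ n - 1 := by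
  have := h.twenty_le_log
  have := h.log_lt
  nlinarith [h.le_one]

lemma nat_le_log {r : ℕ} (hr : (p * (n - 1)) ^ r ≤ n) : (r : ℝ) ≤ Real.log n := by
  have h20 := h.twenty_le_log
  have hn := h.log_lt
  rw [Real.le_log_iff_exp_le (by linarith)]
  refine le_trans ?_ hr
  rw [← mul_one (r : ℝ), Real.exp_nat_mul]
  refine pow_le_pow_left₀ (Real.exp_pos _).le ?_ _
  linarith [Real.exp_one_lt_d9, h.log_le_deg]

lemma one_sub_pow_le (s : ℕ) : (1 - p) ^ s ≤ 1 - p * s + (p * s) ^ 2 / 2 := by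
  refine le_trans ?_ (exp_neg_le_quadratic (mul_nonneg h.nonneg s.cast_nonneg))
  rw [show -(p * s) = s * (-p) by ring, Real.exp_nat_mul]
  exact pow_le_pow_left₀ (by linarith [h.le_one]) (by linarith [Real.add_one_le_exp (-p)]) _

/-- Here y = ps ≤ 4/3, whence y - y²/2 ≥ y/3, and n - s ≥ 7n/8. Valid up to saturation, at the price
of a constant factor. -/
lemma le_sub_mul {s : ℕ} (hs : s * (p * (n - 1)) ≤ (n : ℝ)) :
    s * (p * (n - 1)) / 4 ≤ ((n : ℝ) - s) * (1 - (1 - p) ^ s) := by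
  have h20 := h.twenty_le_log
  have hn := h.log_lt
  have hd := h.log_le_deg
  have hp0 := h.nonneg
  have hs0 : (0 : ℝ) ≤ s := by positivity
  set y : ℝ := p * s with hy
  have hy0 : 0 ≤ y := by positivity
  have hy1 : y * (n - 1) ≤ n := by rw [hy]; linarith
  have hy2 : y ≤ 4 / 3 := by nlinarith
  have h1 : (1 - p) ^ s ≤ 1 - y + y ^ 2 / 2 := h.one_sub_pow_le s
  have h2 : y / 3 ≤ 1 - (1 - p) ^ s := by nlinarith
  have h3 : (7 : ℝ) / 8 * n ≤ n - s := by nlinarith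
  calc s * (p * (n - 1)) / 4 = y * (n - 1) / 4 := by rw [hy]; ring
    _ ≤ (7 / 8 * n) * (y / 3) := by nlinarith
    _ ≤ _ := mul_le_mul h3 h2 (by positivity) (by nlinarith)

/-- Below saturation by a factor of order L, only 1 - O(1/L) is lost, which is affordable in each of
up to L steps. -/
lemma one_sub_mul_le {s : ℕ} (hs : s * (p * (n - 1)) ≤ Real.exp 5 * (n / Real.log n)) :
    (1 - 2 * Real.exp 5 / Real.log n) * (s * (p * (n - 1))) ≤
      ((n : ℝ) - s) * (1 - (1 - p) ^ s) := by
  have h20 := h.twenty_le_log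
  have hL := h.le_log
  have hn := h.log_lt
  have hd := h.log_le_deg
  have hp0 := h.nonneg
  have hs0 : (0 : ℝ) ≤ s := by positivity
  set L := Real.log n with hLdef
  set δ : ℝ := Real.exp 5 / L with hδ
  have hδ0 : 0 ≤ δ := by positivity
  have hδ1 : δ ≤ 1 / 4 := by rw [hδ, div_le_iff₀ (by linarith)]; linarith
  have hs' : s * (p * (n - 1)) ≤ δ * n := by
    refine hs.trans (le_of_eq ?_); rw [hδ]; ring
  set y : ℝ := p * s with hy
  have hy0 : 0 ≤ y := by positivity
  have hy1 : y * (n - 1) ≤ δ * n := by rw [hy]; linarith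
  have hy2 : y ≤ 2 * δ := by nlinarith
  have h1 : (1 - p) ^ s ≤ 1 - y + y ^ 2 / 2 := h.one_sub_pow_le s
  have h2 : y * (1 - δ) ≤ 1 - (1 - p) ^ s := by nlinarith
  have h3 : n * (1 - δ) ≤ (n : ℝ) - s := by nlinarith
  calc (1 - 2 * Real.exp 5 / L) * (s * (p * (n - 1)))
      = (1 - 2 * δ) * (y * (n - 1)) := by rw [hy, hδ]; ring
    _ ≤ (n * (1 - δ)) * (y * (1 - δ)) := by
        have h4 : 0 ≤ y * (n - 1) := mul_nonneg hy0 (by linarith)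
        have h5 : (1 - 2 * δ) ≤ (1 - δ) ^ 2 := by nlinarith
        have h6 : y * (n - 1) ≤ n * y := by nlinarith
        calc _ ≤ (1 - δ) ^ 2 * (n * y) := mul_le_mul h5 h6 h4 (by positivity)
          _ = _ := by ring
    _ ≤ _ := mul_le_mul h3 h2 (mul_nonneg hy0 (by linarith)) (le_trans (by
        have : (0 : ℝ) ≤ 1 - δ := by linarith
        have : (0 : ℝ) ≤ n := by linarith
        positivity) h3)

end IsDense

variable {V : Type*}

/-- Truncation to ⌊n/D⌋ vertices: a set too large for the expansion hypothesis is replaced by a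
subset at the threshold. -/
lemma exists_subset_mul_le {S : Finset V} {n D : ℝ} (hD : 0 < D) (hDn : D ≤ n)
    (h : n < S.card * D) : ∃ S' ⊆ S, S'.Nonempty ∧ S'.card * D ≤ n ∧ n / 2 ≤ S'.card * D := by
  have h1 : ⌊n / D⌋₊ ≤ S.card := by
    apply Nat.floor_le_of_le
    rw [div_le_iff₀ hD]; exact h.le
  have h2 : 1 ≤ ⌊n / D⌋₊ := by
    rw [Nat.one_le_floor_iff, le_div_iff₀ hD]; linarith
  obtain ⟨S', hS', hc⟩ := Finset.exists_subset_card_eq h1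
  refine ⟨S', hS', Finset.card_pos.1 (by omega), ?_, ?_⟩
  · rw [hc, ← le_div_iff₀ hD]
    exact Nat.floor_le (by apply div_nonneg <;> linarith)
  · rw [hc, ← div_le_iff₀ hD]
    have h3 := Nat.lt_floor_add_one (n / D)
    have h4 : (1 : ℝ) ≤ ⌊n / D⌋₊ := by exact_mod_cast h2
    rw [div_div, mul_comm, ← div_div]
    linarith

variable [Fintype V]

/-- Small sets of vertices have almost as many neighbours as in a typical random graph. -/
structure IsExpanding (G : SimpleGraph V) (p : ℝ) : Prop where
  card_closedNbr_le : ∀ v, ((closedNbr G {v}).card : ℝ) ≤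
    p * (Fintype.card V - 1) * (1 + 5 / Real.log (Fintype.card V))
  le_card_closedNbr : ∀ S : Finset V, S.Nonempty →
    S.card * (p * (Fintype.card V - 1)) ≤ Fintype.card V →
    (1 - 5 / Real.log (Fintype.card V)) *
      (((Fintype.card V : ℝ) - S.card) * (1 - (1 - p) ^ S.card)) ≤ (closedNbr G S).card

lemma ball_nonempty (G : SimpleGraph V) {S : Finset V} (hS : S.Nonempty) (r : ℕ) :
    (ball G r S).Nonempty :=
  hS.mono (subset_ball G r S)

namespace IsExpanding

variable {G : SimpleGraph V} {p : ℝ} (hG : IsExpanding G p) (h : IsDense (Fintype.card V) p)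

include hG in
lemma card_closedNbr_le_mul (S : Finset V) : ((closedNbr G S).card : ℝ) ≤
    S.card * (p * (Fintype.card V - 1) * (1 + 5 / Real.log (Fintype.card V))) := by
  classical
  have : closedNbr G S ⊆ S.biUnion fun u => closedNbr G {u} := by
    intro w hw
    obtain ⟨u, hu, hs⟩ := mem_closedNbr.1 hw
    exact Finset.mem_biUnion.2 ⟨u, hu, mem_closedNbr.2 ⟨u, by simp, hs⟩⟩
  calc ((closedNbr G S).card : ℝ) ≤ ((S.biUnion fun u => closedNbr G {u}).card : ℝ) := by
        exact_mod_cast Finset.card_le_card this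
    _ ≤ ∑ u ∈ S, ((closedNbr G {u}).card : ℝ) := by exact_mod_cast Finset.card_biUnion_le
    _ ≤ ∑ u ∈ S, p * (Fintype.card V - 1) * (1 + 5 / Real.log (Fintype.card V)) :=
        Finset.sum_le_sum fun u _ => hG.card_closedNbr_le u
    _ = _ := by rw [Finset.sum_const, nsmul_eq_mul]

include hG h

lemma card_closedNbr_le_two_mul (S : Finset V) : ((closedNbr G S).card : ℝ) ≤
    2 * S.card * (p * (Fintype.card V - 1)) := by
  refine (hG.card_closedNbr_le_mul S).trans ?_
  have h20 := h.twenty_le_log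
  have h1 : 5 / Real.log (Fintype.card V) ≤ 1 := by
    rw [div_le_one (by linarith)]; linarith
  have h2 : 0 ≤ p * (Fintype.card V - 1) := by linarith [h.log_le_deg]
  have h3 : (0 : ℝ) ≤ S.card * (p * (Fintype.card V - 1)) := by positivity
  nlinarith

/-- Each step multiplies the size by at most d(1 + 5/L), and r ≤ L keeps (1 + 5/L)^r below e⁵. -/
lemma card_ball_le {r : ℕ} (hr : r ≤ Real.log (Fintype.card V)) (S : Finset V) :
    ((ball G r S).card : ℝ) ≤ Real.exp 5 * (S.card * (p * (Fintype.card V - 1)) ^ r) := by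
  have h20 := h.twenty_le_log
  have hd := h.log_le_deg
  set L := Real.log (Fintype.card V)
  set d := p * ((Fintype.card V : ℝ) - 1)
  have h1 : ((ball G r S).card : ℝ) ≤ S.card * (d * (1 + 5 / L)) ^ r := by
    clear hr
    induction r with
    | zero => simp [ball_zero]
    | succ r ih =>
      rw [ball_succ]
      refine (hG.card_closedNbr_le_mul _).trans ?_
      have h3 : 0 ≤ 5 / L := by apply div_nonneg <;> linarith
      have h4 : 0 ≤ d * (1 + 5 / L) := mul_nonneg (by linarith) (by linarith)
      calc _ ≤ (S.card * (d * (1 + 5 / L)) ^ r) * (d * (1 + 5 / L)) :=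
            mul_le_mul_of_nonneg_right ih h4
        _ = _ := by ring
  have h2 : (1 + 5 / L) ^ r ≤ Real.exp 5 := by
    have h3 : 0 ≤ 5 / L := by apply div_nonneg <;> linarith
    calc (1 + 5 / L) ^ r ≤ Real.exp (5 / L) ^ r :=
          pow_le_pow_left₀ (by linarith) (by linarith [Real.add_one_le_exp (5 / L)]) _
      _ = Real.exp (r * (5 / L)) := (Real.exp_nat_mul _ _).symm
      _ ≤ _ := by
          apply Real.exp_le_exp.2
          rw [mul_div_assoc', div_le_iff₀ (by linarith)]
          linarith
  refine h1.trans ?_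
  rw [mul_pow]
  have : 0 ≤ S.card * d ^ r := by
    have : 0 ≤ d := by linarith
    positivity
  calc _ = (1 + 5 / L) ^ r * (S.card * d ^ r) := by ring
    _ ≤ _ := mul_le_mul_of_nonneg_right h2 this

/-- Any set expands by a constant proportion of the degree, up to the size of the graph. -/
lemma min_le_card_closedNbr {S : Finset V} (hS : S.Nonempty) :
    1 / 16 * min (S.card * (p * (Fintype.card V - 1))) (Fintype.card V : ℝ) ≤
      (closedNbr G S).card := by
  have h20 := h.twenty_le_log
  have hd := h.log_le_deg
  have key : ∀ T : Finset V, T.Nonempty → T.card * (p * (Fintype.card V - 1)) ≤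
      (Fintype.card V : ℝ) → T.card * (p * (Fintype.card V - 1)) / 8 ≤
      ((closedNbr G T).card : ℝ) := by
    intro T hT hle
    refine le_trans ?_ (hG.le_card_closedNbr T hT hle)
    have h1 := h.le_sub_mul hle
    have h2 : 5 / Real.log (Fintype.card V) ≤ 1 / 2 := by
      rw [div_le_div_iff₀ (by linarith) (by norm_num)]; linarith
    have h3 : (0 : ℝ) ≤ T.card * (p * (Fintype.card V - 1)) :=
      mul_nonneg (by positivity) (by linarith)
    nlinarith
  rcases le_or_gt (S.card * (p * (Fintype.card V - 1))) (Fintype.card V : ℝ) with hle | hlt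
  · rw [min_eq_left hle]
    have h3 : (0 : ℝ) ≤ S.card * (p * (Fintype.card V - 1)) :=
      mul_nonneg (by positivity) (by linarith)
    linarith [key S hS hle]
  · rw [min_eq_right hlt.le]
    obtain ⟨S', hS', hne, h1, h2⟩ := exists_subset_mul_le (by linarith)
      (by linarith [h.deg_le]) hlt
    have h3 := key S' hne h1
    have h4 : ((closedNbr G S').card : ℝ) ≤ (closedNbr G S).card := by
      exact_mod_cast Finset.card_le_card (closedNbr_mono G hS')
    linarith

/-- A step loses (1 - 5/L) from concentration and (1 - 2e⁵/L) from `one_sub_mul_le`, which applies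
because `card_ball_le` keeps the current ball small. -/
lemma pow_mul_le_card_ball {r : ℕ} (hr : r ≤ Real.log (Fintype.card V)) {S : Finset V}
    (hS : S.Nonempty)
    (hle : S.card * (p * (Fintype.card V - 1)) ^ r ≤
      (Fintype.card V : ℝ) / Real.log (Fintype.card V)) :
    (1 - (5 + 2 * Real.exp 5) / Real.log (Fintype.card V)) ^ r *
      (S.card * (p * (Fintype.card V - 1)) ^ r) ≤ (ball G r S).card := by
  have h20 := h.twenty_le_log
  have hL := h.le_log
  have hd := h.log_le_deg
  have hn := h.log_lt
  induction r with
  | zero => simp [ball_zero]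
  | succ r ih =>
    rw [ball_succ]
    set L := Real.log (Fintype.card V)
    set n : ℝ := (Fintype.card V : ℝ)
    set d := p * (n - 1)
    have hr' : (r : ℝ) ≤ L := by push_cast at hr; linarith
    have hd1 : 1 ≤ d := by linarith
    have hle' : S.card * d ^ r ≤ n / L := by
      refine le_trans ?_ hle
      exact mul_le_mul_of_nonneg_left (pow_le_pow_right₀ hd1 (Nat.le_succ r)) (by positivity)
    have h1 := ih hr' hle'
    have h2 := hG.card_ball_le h hr' S
    set t := ball G r S
    have h3 : (t.card : ℝ) * d ≤ Real.exp 5 * (n / L) := by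
      calc (t.card : ℝ) * d ≤ Real.exp 5 * (S.card * d ^ r) * d :=
            mul_le_mul_of_nonneg_right h2 (by linarith)
        _ = Real.exp 5 * (S.card * d ^ (r + 1)) := by ring
        _ ≤ _ := mul_le_mul_of_nonneg_left hle (Real.exp_pos _).le
    have h4 : (t.card : ℝ) * d ≤ n := by
      refine h3.trans ?_
      rw [mul_div_assoc', div_le_iff₀ (by linarith), mul_comm]
      exact mul_le_mul_of_nonneg_left (by linarith [Real.exp_pos 5]) (by linarith)
    have h5 := hG.le_card_closedNbr t (ball_nonempty G hS r) h4
    have h6 := h.one_sub_mul_le h3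
    have h7 : 0 ≤ (t.card : ℝ) * d := mul_nonneg (by positivity) (by linarith)
    have hA : 0 ≤ 1 - (5 + 2 * Real.exp 5) / L := by
      have : (5 + 2 * Real.exp 5) / L ≤ 1 := by
        rw [div_le_one (by linarith)]; linarith [Real.exp_pos 5]
      linarith
    have hB : 0 ≤ 1 - 5 / L := by
      have : 5 / L ≤ 1 := by
        rw [div_le_one (by linarith)]; linarith
      linarith
    have hAB : 1 - (5 + 2 * Real.exp 5) / L ≤ (1 - 5 / L) * (1 - 2 * Real.exp 5 / L) := by
      have : 0 ≤ 5 / L * (2 * Real.exp 5 / L) := by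
        apply mul_nonneg <;> apply div_nonneg <;> linarith [Real.exp_pos 5]
      rw [add_div]
      linarith
    calc _ = (1 - (5 + 2 * Real.exp 5) / L) *
          ((1 - (5 + 2 * Real.exp 5) / L) ^ r * (S.card * d ^ r) * d) := by ring
      _ ≤ (1 - (5 + 2 * Real.exp 5) / L) * (t.card * d) :=
          mul_le_mul_of_nonneg_left (mul_le_mul_of_nonneg_right h1 (by linarith)) hA
      _ ≤ (1 - 5 / L) * (1 - 2 * Real.exp 5 / L) * (t.card * d) :=
          mul_le_mul_of_nonneg_right hAB h7
      _ ≤ (1 - 5 / L) * ((n - t.card) * (1 - (1 - p) ^ t.card)) := by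
          rw [mul_assoc]; exact mul_le_mul_of_nonneg_left h6 hB
      _ ≤ _ := h5

/-- Balls of radius `r + 1` around sets grow like `d ^ (r + 1)`, up to the size of the graph. -/
lemma min_le_card_ball {r : ℕ}
    (hr : (p * (Fintype.card V - 1)) ^ (r + 1) ≤ (Fintype.card V : ℝ))
    {S : Finset V} (hS : S.Nonempty) :
    Real.exp (-(2 * (5 + 2 * Real.exp 5))) / 32 *
      min (S.card * (p * (Fintype.card V - 1)) ^ (r + 1)) (Fintype.card V : ℝ) ≤
      (ball G (r + 1) S).card := by
  have h20 := h.twenty_le_log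
  have hL := h.le_log
  have hd := h.log_le_deg
  have hn := h.log_lt
  have hr' := h.nat_le_log hr
  set L := Real.log (Fintype.card V)
  set n : ℝ := (Fintype.card V : ℝ)
  set d := p * (n - 1)
  set A := 5 + 2 * Real.exp 5
  have hr'' : (r : ℝ) ≤ L := by push_cast at hr'; linarith
  have hd0 : 0 < d := by linarith
  have hc : Real.exp (-(2 * A)) ≤ (1 - A / L) ^ r := by
    have hA0 : 0 ≤ A := by simp only [A]; positivity
    have hx0 : 0 ≤ A / L := div_nonneg hA0 (by linarith)
    -- This is what `IsDense.le_log` is for: 1 - y ≥ exp(-2y) on [0, 1/2].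
    have hx : A / L ≤ 1 / 2 := by
      rw [div_le_div_iff₀ (by linarith) (by norm_num)]; linarith
    have h1 : Real.exp (-(2 * (A / L))) ≤ 1 - A / L := by
      have h2 := Real.add_one_le_exp (2 * (A / L))
      rw [Real.exp_neg]
      have h3 : (Real.exp (2 * (A / L)))⁻¹ ≤ (2 * (A / L) + 1)⁻¹ :=
        inv_anti₀ (by linarith) h2
      refine h3.trans ?_
      rw [inv_le_iff_one_le_mul₀ (by linarith)]
      nlinarith
    calc Real.exp (-(2 * A)) ≤ Real.exp (r * (-(2 * (A / L)))) := by
          apply Real.exp_le_exp.2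
          have : (r : ℝ) * (A / L) ≤ A := by
            rw [mul_div_assoc', div_le_iff₀ (by linarith)]
            nlinarith
          linarith
      _ = Real.exp (-(2 * (A / L))) ^ r := Real.exp_nat_mul _ _
      _ ≤ _ := pow_le_pow_left₀ (Real.exp_pos _).le h1 _
  have hc1 : Real.exp (-(2 * A)) ≤ 1 :=
    Real.exp_le_one_iff.2 (by simp only [A]; linarith [Real.exp_pos 5])
  have hc0 := Real.exp_pos (-(2 * A))
  set c := Real.exp (-(2 * A))
  have key : ∀ T : Finset V, T.Nonempty → T.card * d ^ (r + 1) ≤ n →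
      c / 16 * (T.card * d ^ (r + 1)) ≤ (ball G (r + 1) T).card := by
    intro T hT hle
    -- As d ≥ L, the first r steps stay in the sharp range; only the last step costs a constant
    -- factor.
    have h1 : T.card * d ^ r ≤ n / L := by
      rw [le_div_iff₀ (by linarith)]
      refine le_trans ?_ hle
      rw [pow_succ, ← mul_assoc]
      exact mul_le_mul_of_nonneg_left hd (by positivity)
    have h2 := hG.pow_mul_le_card_ball h hr'' hT h1
    have h3 : c * (T.card * d ^ r) ≤ (ball G r T).card :=
      (mul_le_mul_of_nonneg_right hc (by positivity)).trans h2
    have h4 := hG.min_le_card_closedNbr h (ball_nonempty G hT r)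
    rw [ball_succ]
    refine le_trans ?_ h4
    have h5 : c * (T.card * d ^ (r + 1)) ≤ min ((ball G r T).card * d) n := by
      apply le_min
      · rw [pow_succ, ← mul_assoc, ← mul_assoc, mul_assoc c]
        exact mul_le_mul_of_nonneg_right h3 hd0.le
      · refine le_trans ?_ hle
        exact mul_le_of_le_one_left (by positivity) hc1
    linarith
  rcases le_or_gt (S.card * d ^ (r + 1)) n with hle | hlt
  · rw [min_eq_left hle]
    have h1 : 0 ≤ c * (S.card * d ^ (r + 1)) := by positivity
    linarith [key S hS hle]
  · rw [min_eq_right hlt.le]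
    obtain ⟨S', hS', hne, h1, h2⟩ := exists_subset_mul_le (by positivity) hr hlt
    have h3 := key S' hne h1
    have h4 : ((ball G (r + 1) S').card : ℝ) ≤ (ball G (r + 1) S).card := by
      exact_mod_cast Finset.card_le_card (ball_mono G _ hS')
    nlinarith

end IsExpanding

end Expansion

/-! ### Chernoff bounds and the law of neighbourhood sizes -/

section RandomGraph

open MeasureTheory ProbabilityTheory

section Chernoff

variable {Ω : Type*} [MeasurableSpace Ω] {P : Measure Ω} [IsProbabilityMeasure P] {X : Ω → ℝ}
  {m ε : ℝ}

/-- Exponential Markov inequality at t = -ε, for a moment generating function dominated by that of a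
Poisson variable of mean m. -/
lemma measureReal_le_one_sub_mul_le (hint : ∀ t, Integrable (fun ω => Real.exp (t * X ω)) P)
    (h : ∀ t, mgf X P t ≤ Real.exp (m * (Real.exp t - 1))) (hm : 0 ≤ m) (hε : 0 ≤ ε) :
    P.real {ω | X ω ≤ (1 - ε) * m} ≤ Real.exp (-(ε ^ 2 * m / 2)) := by
  refine (measure_le_le_exp_mul_mgf _ (neg_nonpos.2 hε) (hint _)).trans ?_
  refine (mul_le_mul_of_nonneg_left (h _) (Real.exp_pos _).le).trans ?_
  rw [← Real.exp_add]
  apply Real.exp_le_exp.2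
  nlinarith [exp_neg_le_quadratic hε]

/-- The same at t = ε/2, using exp t ≤ 1 + t + t². -/
lemma measureReal_one_add_mul_le_le (hint : ∀ t, Integrable (fun ω => Real.exp (t * X ω)) P)
    (h : ∀ t, mgf X P t ≤ Real.exp (m * (Real.exp t - 1))) (hm : 0 ≤ m) (hε : 0 ≤ ε)
    (hε1 : ε ≤ 1) :
    P.real {ω | (1 + ε) * m ≤ X ω} ≤ Real.exp (-(ε ^ 2 * m / 4)) := by
  refine (measure_ge_le_exp_mul_mgf _ (by linarith : (0 : ℝ) ≤ ε / 2) (hint _)).trans ?_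
  refine (mul_le_mul_of_nonneg_left (h _) (Real.exp_pos _).le).trans ?_
  rw [← Real.exp_add]
  apply Real.exp_le_exp.2
  have h1 := Real.abs_exp_sub_one_sub_id_le (x := ε / 2) (by
    rw [abs_of_nonneg (by linarith)]; linarith)
  nlinarith [(abs_le.1 h1).2]

end Chernoff

/-- The law of a single edge. -/
noncomputable def edgeLaw (p : unitInterval) : Measure Prop :=
  (unitInterval.toNNReal p) • Measure.dirac True +
    (unitInterval.toNNReal (unitInterval.symm p)) • Measure.dirac False

lemma edgeLaw_false (p : unitInterval) : (edgeLaw p).real {False} = 1 - p := by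
  simp [edgeLaw, measureReal_def]

instance (p : unitInterval) : IsProbabilityMeasure (edgeLaw p) := by
  refine ⟨?_⟩
  simp [edgeLaw]

section RowLaw

variable {V : Type*}

lemma measurable_adj (S : Finset V) :
    Measurable fun (G : SimpleGraph V) (w : {w // w ∉ S}) (u : {u // u ∈ S}) => G.Adj u w := by
  refine measurable_pi_lambda _ fun w => measurable_pi_lambda _ fun u => ?_
  exact (SimpleGraph.measurable_iff_adj.1 measurable_id) _ _

variable [Fintype V]

/-- Pairs (w, u) with w outside S and u in S are distinct non-diagonal edges, so these entries are
independent. -/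
lemma map_adj_binomialRandom (S : Finset V) (p : unitInterval) :
    (SimpleGraph.binomialRandom V p).map
      (fun G (w : {w // w ∉ S}) (u : {u // u ∈ S}) => G.Adj u w) =
    Measure.infinitePi fun _ : {w // w ∉ S} => Measure.infinitePi fun _ : {u // u ∈ S} =>
      edgeLaw p := by
  classical
  let f : (Σ _ : {w // w ∉ S}, {u // u ∈ S}) → Sym2 V := fun x => s(x.2.1, x.1.1)
  have hf : Function.Injective f := by
    rintro ⟨⟨w, hw⟩, ⟨u, hu⟩⟩ ⟨⟨w', hw'⟩, ⟨u', hu'⟩⟩ h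
    simp only [f, Sym2.eq_iff] at h
    rcases h with ⟨rfl, rfl⟩ | ⟨rfl, rfl⟩
    · rfl
    · exact absurd hu hw'
  have hmeas := measurable_adj S
  have hmeas' : Measurable fun p : Sym2 V → Prop => {i | p i} := by fun_prop
  rw [SimpleGraph.binomialRandom_eq_map, setBernoulli_eq_map,
    Measure.map_map SimpleGraph.measurable_fromEdgeSet hmeas',
    Measure.map_map hmeas (SimpleGraph.measurable_fromEdgeSet.comp hmeas')]
  have h1 := Measure.map_infinitePi_infinitePi_of_inj (P := fun i : Sym2 V =>
    unitInterval.toNNReal p • Measure.dirac (i ∈ (Sym2.diagSet : Set (Sym2 V))ᶜ) +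
      unitInterval.toNNReal (unitInterval.symm p) • Measure.dirac False) hf
  have h2 : ∀ x, (unitInterval.toNNReal p • Measure.dirac
      (f x ∈ (Sym2.diagSet : Set (Sym2 V))ᶜ) +
      unitInterval.toNNReal (unitInterval.symm p) • Measure.dirac False) = edgeLaw p := by
    rintro ⟨⟨w, hw⟩, ⟨u, hu⟩⟩
    have : (f ⟨⟨w, hw⟩, ⟨u, hu⟩⟩ ∈ (Sym2.diagSet : Set (Sym2 V))ᶜ) = True := by
      simp only [f, Set.mem_compl_iff, Sym2.mem_diagSet, Sym2.mk_isDiag_iff, eq_iff_iff,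
        iff_true]
      rintro rfl
      exact hw hu
    rw [this]
    rfl
  simp only [h2] at h1
  have h3 := Measure.infinitePi_map_piCurry
    (fun (_ : {w // w ∉ S}) (_ : {u // u ∈ S}) => edgeLaw p)
  rw [← h3, ← h1, Measure.map_map (by fun_prop) (by fun_prop)]
  congr 1
  funext ω w u
  have : (u : V) ≠ w := fun h => w.2 (h ▸ u.2)
  simp [f, this, MeasurableEquiv.piCurry, Sigma.curry]

open Classical in
/-- Indicator of the event that some entry of a row of the adjacency matrix is non-zero. -/
noncomputable def rowHit {U : Type*} (b : U → Prop) : ℝ := if ∃ u, b u then 1 else 0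

open Classical in
lemma card_closedNbr_eq (G : SimpleGraph V) (S : Finset V) : ((closedNbr G S).card : ℝ) =
    S.card + ∑ w : {w // w ∉ S}, rowHit fun u : {u // u ∈ S} => G.Adj u w := by
  have h : closedNbr G S = S ∪ (Finset.univ.filter fun w : {w // w ∉ S} =>
      ∃ u : {u // u ∈ S}, G.Adj u w).map (.subtype _) := by
    ext w
    simp only [mem_closedNbr, Step, Finset.mem_union, Finset.mem_map, Finset.mem_filter,
      Finset.mem_univ, true_and, Function.Embedding.subtype_apply, Subtype.exists,
      exists_and_right, exists_eq_right, exists_prop]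
    by_cases hw : w ∈ S
    · simp only [hw, true_or, iff_true]
      exact ⟨w, hw, Or.inl rfl⟩
    · simp only [hw, false_or, not_false_eq_true]
      constructor
      · rintro ⟨u, hu, rfl | h⟩
        · exact absurd hu hw
        · exact ⟨trivial, u, hu, h⟩
      · rintro ⟨-, u, hu, h⟩
        exact ⟨u, hu, Or.inr h⟩
  rw [h, Finset.card_union_of_disjoint, Finset.card_map, Nat.cast_add]
  · simp [rowHit]
  · rw [Finset.disjoint_left]
    intro x hx hx'
    obtain ⟨y, -, rfl⟩ := Finset.mem_map.1 hx'
    exact y.2 hx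

lemma measurable_rowHit {U : Type*} [Finite U] : Measurable (rowHit : (U → Prop) → ℝ) := by
  classical
  have := Fintype.ofFinite U
  refine Measurable.ite ?_ measurable_const measurable_const
  exact Measurable.setOf (Measurable.exists fun u => measurable_pi_apply u)

/-- `rowHit` vanishes exactly on the all-false row, which has probability (1-p)^|U|. -/
lemma mgf_rowHit {U : Type*} [Fintype U] (p : unitInterval) (t : ℝ) :
    mgf rowHit (Measure.infinitePi fun _ : U => edgeLaw p) t =
      1 + (1 - (1 - (p : ℝ)) ^ Fintype.card U) * (Real.exp t - 1) := by
  classical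
  set P := Measure.infinitePi fun _ : U => edgeLaw p
  let A : Set (U → Prop) := Set.pi Set.univ fun _ => {False}
  have hA : MeasurableSet A := .univ_pi fun _ => MeasurableSet.singleton _
  have hPA : P.real A = (1 - (p : ℝ)) ^ Fintype.card U := by
    have h := Measure.infinitePi_pi (fun _ : U => edgeLaw p) (s := Finset.univ)
      (t := fun _ => {False}) (fun _ _ => MeasurableSet.singleton _)
    rw [Finset.coe_univ] at h
    rw [measureReal_def, h, Finset.prod_const, ENNReal.toReal_pow, ← measureReal_def,
      edgeLaw_false, Finset.card_univ]
  have hfun : (fun b : U → Prop => Real.exp (t * rowHit b)) =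
      fun b => Real.exp t + A.indicator (fun _ => 1 - Real.exp t) b := by
    funext b
    by_cases hb : ∃ u, b u
    · have : b ∉ A := by
        obtain ⟨u, hu⟩ := hb
        intro h
        have := h u (Set.mem_univ _)
        simp [hu] at this
      simp [rowHit, hb, this]
    · have : b ∈ A := by
        intro u _
        have : ¬ b u := fun h => hb ⟨u, h⟩
        simp [this]
      simp [rowHit, hb, this]
  rw [mgf, hfun, integral_add (integrable_const _) ((integrable_const _).indicator hA),
    integral_indicator_const _ hA, hPA]
  simp only [integral_const, probReal_univ, smul_eq_mul, one_mul]
  ring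

/-- Rows are independent and 1 + x ≤ exp x; this is the Poisson bound the Chernoff lemmas require.
-/
lemma mgf_sum_rowHit {U W : Type*} [Fintype U] [Fintype W] (p : unitInterval) (t : ℝ) :
    mgf (fun b : W → U → Prop => ∑ w, rowHit (b w))
      (Measure.infinitePi fun _ : W => Measure.infinitePi fun _ : U => edgeLaw p) t ≤
      Real.exp (Fintype.card W * (1 - (1 - (p : ℝ)) ^ Fintype.card U) * (Real.exp t - 1)) := by
  have h1 := iIndepFun_infinitePi (P := fun _ : W => Measure.infinitePi fun _ : U => edgeLaw p)
    (X := fun _ => rowHit) (fun _ => measurable_rowHit)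
  have h2 := h1.mgf_sum (t := t)
    (fun w => measurable_rowHit.comp (measurable_pi_apply w)) Finset.univ
  have h3 : (∑ w, fun b : W → U → Prop => rowHit (b w)) =
      fun b : W → U → Prop => ∑ w, rowHit (b w) := by
    funext b; simp
  rw [h3] at h2
  rw [h2, mul_assoc, Real.exp_nat_mul]
  have h4 : ∀ w : W, mgf (fun b : W → U → Prop => rowHit (b w))
      (Measure.infinitePi fun _ : W => Measure.infinitePi fun _ : U => edgeLaw p) t =
      1 + (1 - (1 - (p : ℝ)) ^ Fintype.card U) * (Real.exp t - 1) := by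
    intro w
    have h5 := Measure.infinitePi_map_eval
      (fun _ : W => Measure.infinitePi fun _ : U => edgeLaw p) w
    have h6 := mgf_rowHit (U := U) p t
    rw [← h5] at h6
    rw [← h6]
    refine (mgf_map (X := rowHit) (measurable_pi_apply w).aemeasurable ?_).symm
    exact ((measurable_rowHit.const_mul t).exp).aestronglyMeasurable
  simp only [h4, Finset.prod_const, Finset.card_univ]
  refine pow_le_pow_left₀ ?_ (by rw [add_comm]; exact Real.add_one_le_exp _) _
  have h5 : 0 ≤ (1 - (p : ℝ)) ^ Fintype.card U := pow_nonneg (by linarith [p.2.2]) _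
  have h6 : (1 - (p : ℝ)) ^ Fintype.card U ≤ 1 :=
    pow_le_one₀ (by linarith [p.2.2]) (by linarith [p.2.1])
  nlinarith [Real.exp_pos t]

lemma integrable_exp_sum_rowHit {U W : Type*} [Fintype U] [Fintype W]
    (P : Measure (W → U → Prop)) [IsProbabilityMeasure P] (t : ℝ) :
    Integrable (fun b => Real.exp (t * ∑ w, rowHit (b w))) P := by
  refine Integrable.of_bound (C := Real.exp (|t| * Fintype.card W)) ?_ (.of_forall fun b => ?_)
  · refine Measurable.aestronglyMeasurable ?_
    refine Measurable.exp (Measurable.const_mul ?_ t)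
    exact Finset.measurable_sum _ fun w _ => measurable_rowHit.comp (measurable_pi_apply w)
  · rw [Real.norm_eq_abs, Real.abs_exp]
    apply Real.exp_le_exp.2
    have h0 : ∀ w, 0 ≤ rowHit (b w) ∧ rowHit (b w) ≤ 1 := by
      intro w; unfold rowHit; split_ifs <;> norm_num
    have h1 : 0 ≤ ∑ w, rowHit (b w) := Finset.sum_nonneg fun w _ => (h0 w).1
    have h2 : ∑ w, rowHit (b w) ≤ Fintype.card W := by
      refine (Finset.sum_le_sum fun w _ => (h0 w).2).trans ?_
      simp
    exact mul_le_mul (le_abs_self t) h2 h1 (abs_nonneg t)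

end RowLaw

end RandomGraph

/-! ### Random graphs are expanding -/

section RandomExpansion

open MeasureTheory ProbabilityTheory

variable {V : Type*} [Fintype V]

lemma measurable_sum_rowHit {U W : Type*} [Fintype U] [Fintype W] :
    Measurable fun b : W → U → Prop => ∑ w, rowHit (b w) :=
  Finset.measurable_sum _ fun w _ => measurable_rowHit.comp (measurable_pi_apply w)

lemma card_compl_subtype (S : Finset V) [Fintype {w // w ∉ S}] :
    (Fintype.card {w // w ∉ S} : ℝ) = Fintype.card V - S.card := by
  classical
  have := Fintype.card_subtype_compl (fun w => w ∈ S)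
  rw [Fintype.card_coe] at this
  rw [← Nat.cast_sub (Finset.card_le_univ S), ← this]

lemma mean_nonneg (S : Finset V) (p : unitInterval) :
    0 ≤ ((Fintype.card V : ℝ) - S.card) * (1 - (1 - (p : ℝ)) ^ S.card) := by
  refine mul_nonneg (sub_nonneg.2 (by exact_mod_cast Finset.card_le_univ S)) (sub_nonneg.2 ?_)
  exact pow_le_one₀ (by linarith [p.2.2]) (by linarith [p.2.1])

lemma measureReal_card_closedNbr_le (S : Finset V) (p : unitInterval) {ε : ℝ} (hε : 0 ≤ ε) :
    (SimpleGraph.binomialRandom V p).real {G | ((closedNbr G S).card : ℝ) ≤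
      (1 - ε) * (((Fintype.card V : ℝ) - S.card) * (1 - (1 - (p : ℝ)) ^ S.card))} ≤
    Real.exp (-(ε ^ 2 *
      (((Fintype.card V : ℝ) - S.card) * (1 - (1 - (p : ℝ)) ^ S.card)) / 2)) := by
  classical
  set m := ((Fintype.card V : ℝ) - S.card) * (1 - (1 - (p : ℝ)) ^ S.card)
  have h1 := measureReal_le_one_sub_mul_le (P := Measure.infinitePi fun _ : {w // w ∉ S} =>
    Measure.infinitePi fun _ : {u // u ∈ S} => edgeLaw p) (m := m)
    (integrable_exp_sum_rowHit _) (fun t => by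
      have := mgf_sum_rowHit (U := {u // u ∈ S}) (W := {w // w ∉ S}) p t
      rwa [card_compl_subtype, Fintype.card_coe] at this) (mean_nonneg S p) hε
  rw [← map_adj_binomialRandom, map_measureReal_apply (measurable_adj S)
    (measurableSet_le measurable_sum_rowHit measurable_const)] at h1
  refine le_trans (measureReal_mono ?_) h1
  intro G hG
  simp only [Set.mem_ofPred_eq, Set.mem_preimage, card_closedNbr_eq] at hG ⊢
  have : (0 : ℝ) ≤ S.card := by positivity
  linarith

lemma measureReal_le_card_closedNbr (v : V) (p : unitInterval) {ε : ℝ} (hε : 0 ≤ ε)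
    (hε1 : ε ≤ 1) :
    (SimpleGraph.binomialRandom V p).real {G |
      1 + (1 + ε) * (p * ((Fintype.card V : ℝ) - 1)) ≤ ((closedNbr G {v}).card : ℝ)} ≤
    Real.exp (-(ε ^ 2 * (p * ((Fintype.card V : ℝ) - 1)) / 4)) := by
  classical
  have hm := mean_nonneg {v} p
  have hm' : ((Fintype.card V : ℝ) - ({v} : Finset V).card) *
      (1 - (1 - (p : ℝ)) ^ ({v} : Finset V).card) = p * ((Fintype.card V : ℝ) - 1) := by
    simp; ring
  have h1 := measureReal_one_add_mul_le_le (P := Measure.infinitePi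
    fun _ : {w // w ∉ ({v} : Finset V)} =>
    Measure.infinitePi fun _ : {u // u ∈ ({v} : Finset V)} => edgeLaw p)
    (integrable_exp_sum_rowHit _) (fun t => by
      have := mgf_sum_rowHit (U := {u // u ∈ ({v} : Finset V)})
        (W := {w // w ∉ ({v} : Finset V)}) p t
      rwa [card_compl_subtype, Fintype.card_coe, hm'] at this) (hm' ▸ hm) hε hε1
  rw [← map_adj_binomialRandom, map_measureReal_apply (measurable_adj _)
    (measurableSet_le measurable_const measurable_sum_rowHit)] at h1
  refine le_trans (measureReal_mono ?_) h1
  intro G hG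
  simp only [Set.mem_ofPred_eq, Set.mem_preimage, card_closedNbr_eq] at hG ⊢
  simp only [Finset.card_singleton, Nat.cast_one] at hG
  linarith

/-- A random graph in the dense range is expanding with high probability. -/
theorem measureReal_not_isExpanding_le {p : unitInterval} (h : IsDense (Fintype.card V) p) :
    (SimpleGraph.binomialRandom V p).real {G | ¬ IsExpanding G p} ≤ 3 / Fintype.card V := by
  classical
  have h20 := h.twenty_le_log
  have hd := h.log_le_deg
  have hd3 := h.le_deg
  have hn := h.log_lt
  set n : ℝ := (Fintype.card V : ℝ) with hndef
  set L := Real.log n with hL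
  set d := (p : ℝ) * (n - 1) with hddef
  set P := SimpleGraph.binomialRandom V p
  have hn0 : 0 < n := by linarith
  let s : Finset (Finset V) := (Finset.univ.powerset.erase ∅).filter fun S => S.card * d ≤ n
  -- 4/L rather than 5/L: the remaining d/L ≥ 1 absorbs the vertex v itself.
  let E₁ : V → Set (SimpleGraph V) := fun v => {G | 1 + (1 + 4 / L) * d ≤ (closedNbr G {v}).card}
  let E₂ : Finset V → Set (SimpleGraph V) := fun S => {G | ((closedNbr G S).card : ℝ) ≤
      (1 - 5 / L) * ((n - S.card) * (1 - (1 - (p : ℝ)) ^ S.card))}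
  have hsub : {G : SimpleGraph V | ¬ IsExpanding G p} ⊆
      (⋃ v ∈ (Finset.univ : Finset V), E₁ v) ∪ ⋃ S ∈ s, E₂ S := by
    intro G hG
    by_contra hcon
    simp only [Set.mem_union, Set.mem_iUnion, not_or, not_exists] at hcon
    refine hG ⟨fun v => ?_, fun S hS hle => ?_⟩
    · have h1 := hcon.1 v (Finset.mem_univ _)
      simp only [E₁, Set.mem_ofPred_eq, not_le] at h1
      refine h1.le.trans ?_
      change _ ≤ d * (1 + 5 / L)
      have h2 : 1 ≤ d * (1 / L) := by
        rw [mul_one_div, le_div_iff₀ (by linarith)]; linarith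
      have h3 : d * (1 + 5 / L) = (1 + 4 / L) * d + d * (1 / L) := by ring
      linarith
    · have h1 := hcon.2 S (by
        simp only [s, Finset.mem_filter, Finset.mem_erase, Finset.mem_powerset]
        exact ⟨⟨hS.ne_empty, Finset.subset_univ S⟩, hle⟩)
      simp only [E₂, Set.mem_ofPred_eq, not_le] at h1
      exact h1.le
  have hE₁ : ∀ v, P.real (E₁ v) ≤ (n ^ 4)⁻¹ := by
    intro v
    refine (measureReal_le_card_closedNbr v p (ε := 4 / L) (by positivity) ?_).trans ?_
    · rw [div_le_one (by linarith)]; linarith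
    · change Real.exp (-((4 / L) ^ 2 * d / 4)) ≤ _
      have h1 : 4 * L ≤ (4 / L) ^ 2 * d / 4 := by
        have : (4 / L) ^ 2 * d / 4 = 4 * d / L ^ 2 := by ring
        rw [this, le_div_iff₀ (by positivity)]
        linarith
      calc _ ≤ Real.exp (-(4 * L)) := Real.exp_le_exp.2 (by linarith)
        _ = _ := by
          rw [Real.exp_neg, show 4 * L = ((4 : ℕ) : ℝ) * L by norm_num, Real.exp_nat_mul, hL,
            Real.exp_log hn0]
  -- The Chernoff exponent is at least 25|S|d/(8L²), which exceeds 3|S|L because d ≥ L³; the bound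
  -- n^(-3|S|) beats the number of sets of size |S|.
  have hE₂ : ∀ S ∈ s, P.real (E₂ S) ≤ Real.exp (-(3 * L)) ^ S.card := by
    intro S hS
    have hle : S.card * d ≤ n := (Finset.mem_filter.1 hS).2
    refine (measureReal_card_closedNbr_le S p (ε := 5 / L) (by positivity)).trans ?_
    have h1 := h.le_sub_mul hle
    rw [← Real.exp_nat_mul]
    apply Real.exp_le_exp.2
    have h2 : S.card * L ^ 3 ≤ S.card * d := mul_le_mul_of_nonneg_left hd3 (by positivity)
    have h3 : S.card * (3 * L) ≤ (5 / L) ^ 2 * (S.card * d / 4) / 2 := by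
      have : (5 / L) ^ 2 * (S.card * d / 4) / 2 = 25 * (S.card * d) / (8 * L ^ 2) := by
        field_simp; ring
      rw [this, le_div_iff₀ (by positivity)]
      have : (0 : ℝ) ≤ S.card * L ^ 3 := by positivity
      nlinarith
    have h4 : (5 / L) ^ 2 * (S.card * d / 4) / 2 ≤
        (5 / L) ^ 2 * ((n - S.card) * (1 - (1 - (p : ℝ)) ^ S.card)) / 2 := by
      have := mul_le_mul_of_nonneg_left h1 (sq_nonneg (5 / L))
      linarith
    linarith
  calc P.real {G | ¬ IsExpanding G p}
      ≤ P.real (⋃ v ∈ (Finset.univ : Finset V), E₁ v) + P.real (⋃ S ∈ s, E₂ S) :=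
        (measureReal_mono hsub).trans (measureReal_union_le _ _)
    _ ≤ ∑ v : V, P.real (E₁ v) + ∑ S ∈ s, P.real (E₂ S) :=
        add_le_add (measureReal_biUnion_finset_le _ _) (measureReal_biUnion_finset_le _ _)
    _ ≤ ∑ _v : V, (n ^ 4)⁻¹ + ∑ S ∈ s, Real.exp (-(3 * L)) ^ S.card :=
        add_le_add (Finset.sum_le_sum fun v _ => hE₁ v) (Finset.sum_le_sum hE₂)
    _ ≤ n * (n ^ 4)⁻¹ + 2 * (n ^ 2)⁻¹ := by
        apply add_le_add
        · simp [← hndef]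
        · refine (Finset.sum_le_sum_of_subset_of_nonneg (Finset.filter_subset _ _)
            fun _ _ _ => by positivity).trans ?_
          convert sum_powerset_erase_pow_card_le (Finset.univ : Finset V) (n := n) (by linarith)
            (by simp [hndef])
    _ ≤ 3 / n := by
        have h1 : n * (n ^ 4)⁻¹ ≤ 1 / n := by
          rw [← div_eq_mul_inv, div_le_div_iff₀ (by positivity) hn0]
          nlinarith [pow_le_pow_right₀ (by linarith : 1 ≤ n) (by norm_num : 2 ≤ 4)]
        have h2 : 2 * (n ^ 2)⁻¹ ≤ 2 / n := by
          rw [← div_eq_mul_inv, div_le_div_iff₀ (by positivity) hn0]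
          nlinarith
        have h3 : 3 / n = 1 / n + 2 / n := by ring
        linarith

end RandomExpansion

/-! ### Winning strategies in the three ranges of d^(r+1) -/

section CopNumber

lemma exists_cover_of_card_le {V : Type*} (b : ℕ) (m : ℕ) (S : Finset V)
    (hS : S.card ≤ m * b) :
    ∃ B : ℕ → Finset V, (∀ j, (B j).card ≤ b) ∧ ∀ u ∈ S, ∃ j < m, u ∈ B j := by
  classical
  induction m generalizing S with
  | zero =>
    refine ⟨fun _ => ∅, by simp, fun u hu => ?_⟩
    have : S.card = 0 := by omega
    simp [Finset.card_eq_zero.1 this] at hu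
  | succ m ih =>
    obtain ⟨T, hT, hc⟩ := Finset.exists_subset_card_eq (min_le_right b S.card)
    obtain ⟨B, hB, hcov⟩ := ih (S \ T) (by
      rw [Finset.card_sdiff_of_subset hT, hc]
      rw [add_mul, one_mul] at hS
      omega)
    refine ⟨Function.update B m T, fun j => ?_, fun u hu => ?_⟩
    · by_cases hj : j = m
      · subst hj; simp [hc]
      · simpa [hj] using hB j
    · by_cases huT : u ∈ T
      · exact ⟨m, Nat.lt_succ_self m, by simpa using huT⟩
      · obtain ⟨j, hj, hju⟩ := hcov u (Finset.mem_sdiff.2 ⟨hu, huT⟩)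
        exact ⟨j, by omega, by simpa [hj.ne] using hju⟩

variable {V : Type*}

lemma copNumber_le {G : SimpleGraph V} {k : ℕ} (hk : 1 ≤ k) (h : CopsWin G k) :
    copNumber G ≤ k :=
  Nat.sInf_le ⟨hk, h⟩

variable [Fintype V]

/-- If balls of radius `R` are large, then few cops can guard every one of `n` given sets of
size `O(√n)`. -/
lemma exists_guards {G : SimpleGraph V} {M c : ℝ} (hM : 0 ≤ M) (hc : 0 < c) {R k : ℕ}
    (hV : 4 ≤ Fintype.card V) (hk0 : 0 < k)
    (hk : 2 * (4 + 2 * M) / c * √(Fintype.card V) ≤ k) (Z : V → Finset V)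
    (hZ : ∀ v, ((Z v).card : ℝ) ≤ M * √(Fintype.card V))
    (hN : ∀ S : Finset V, S.Nonempty →
      c * min (S.card * √(Fintype.card V) * Real.log (Fintype.card V)) (Fintype.card V) ≤
        (ball G R S).card) :
    ∃ a : Fin k → V, ∀ v, Guards G R a (Z v) := by
  classical
  obtain ⟨a, ha⟩ := exists_placement_hall hM hc hV hk Z (ball G R) hZ
    (fun v S _ hS => hN S hS) le_rfl
  refine ⟨a, fun v => ?_⟩
  obtain ⟨U, W, hU, ⟨f, hinj, hf⟩, hcov⟩ := exists_guards_of_deficiency (G := G) (R := R) (K := 0)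
    hk0 (a := a) (B := Z v) (fun T hT => by
      have := ha v T hT
      simp only [add_zero]
      convert this)
  have hUe : U = ∅ := Finset.card_eq_zero.1 (Nat.le_zero.1 hU)
  have hW : ∀ u ∈ Z v, u ∈ W := fun u hu => by simpa [hUe] using hcov u hu
  exact ⟨f, fun u hu w hw => hinj (hW u hu) (hW w hw), fun u hu => hf u (hW u hu)⟩

/-- The constant with which balls of sets grow in an expanding graph. -/
noncomputable def ballConst : ℝ := Real.exp (-(2 * (5 + 2 * Real.exp 5))) / 32

lemma ballConst_pos : 0 < ballConst := by unfold ballConst; positivity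

lemma ballConst_le_one : ballConst ≤ 1 := by
  have : Real.exp (-(2 * (5 + 2 * Real.exp 5))) ≤ 1 :=
    Real.exp_le_one_iff.2 (by linarith [Real.exp_pos 5])
  unfold ballConst
  linarith

namespace IsExpanding

variable {G : SimpleGraph V} {p : ℝ} (hG : IsExpanding G p) (h : IsDense (Fintype.card V) p)
include hG h

lemma min_le_card_ball_of_le {r : ℕ} {D : ℝ}
    (hr : (p * (Fintype.card V - 1)) ^ (r + 1) ≤ (Fintype.card V : ℝ))
    (hD : D ≤ (p * (Fintype.card V - 1)) ^ (r + 1)) {S : Finset V} (hS : S.Nonempty) :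
    ballConst * min (S.card * D) (Fintype.card V : ℝ) ≤ (ball G (r + 1) S).card := by
  refine le_trans ?_ (hG.min_le_card_ball h hr hS)
  refine mul_le_mul_of_nonneg_left (min_le_min_right _ ?_) ballConst_pos.le
  exact mul_le_mul_of_nonneg_left hD (by positivity)

/-- One more step makes up for the missing logarithmic factor. -/
lemma min_le_card_ball_succ {r : ℕ}
    (hr : (p * (Fintype.card V - 1)) ^ (r + 1) ≤ (Fintype.card V : ℝ))
    (hD : √(Fintype.card V) ≤ (p * (Fintype.card V - 1)) ^ (r + 1)) {S : Finset V}
    (hS : S.Nonempty) :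
    ballConst / 16 * min (S.card * √(Fintype.card V) * Real.log (Fintype.card V))
      (Fintype.card V : ℝ) ≤ (ball G (r + 2) S).card := by
  have h20 := h.twenty_le_log
  have hd := h.log_le_deg
  have hn := h.log_lt
  have h1 := hG.min_le_card_ball_of_le h hr hD hS
  have h2 := hG.min_le_card_closedNbr h (ball_nonempty G hS (r + 1))
  rw [← ball_succ] at h2
  have hc0 := ballConst_pos
  have hc1 := ballConst_le_one
  set n : ℝ := (Fintype.card V : ℝ)
  set L := Real.log n
  set d := p * (n - 1)
  have h3 : ballConst * min (S.card * √n * L) n ≤ min ((ball G (r + 1) S).card * d) n := by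
    have h0 : 0 ≤ min (S.card * √n) n := le_min (by positivity) (by linarith)
    apply le_min
    · calc ballConst * min (S.card * √n * L) n
          ≤ ballConst * (min (S.card * √n) n * d) := by
            refine mul_le_mul_of_nonneg_left ?_ hc0.le
            rw [min_mul_of_nonneg _ _ (by linarith : (0 : ℝ) ≤ d)]
            refine min_le_min ?_ ?_
            · exact mul_le_mul_of_nonneg_left hd (by positivity)
            · nlinarith
        _ = ballConst * min (S.card * √n) n * d := by ring
        _ ≤ _ := mul_le_mul_of_nonneg_right h1 (by linarith)
    · have h4 : min (S.card * √n * L) n ≤ n := min_le_right _ _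
      have h5 : 0 ≤ min (S.card * √n * L) n := le_min (by positivity) (by linarith)
      nlinarith
  calc _ = 1 / 16 * (ballConst * min (S.card * √n * L) n) := by ring
    _ ≤ _ := by linarith

/-- The case in which the balls of some radius jump over the critical window. -/
lemma copsWin_of_gap {r k : ℕ} (hk0 : 0 < k)
    (hk : 2 * (4 + 2 * Real.exp 5) / (ballConst / 16) * √(Fintype.card V) ≤ k)
    (hr0 : (p * (Fintype.card V - 1)) ^ r ≤ √(Fintype.card V))
    (hr : (p * (Fintype.card V - 1)) ^ (r + 1) ≤ (Fintype.card V : ℝ))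
    (hD : √(Fintype.card V) * Real.log (Fintype.card V) ≤
      (p * (Fintype.card V - 1)) ^ (r + 1)) : CopsWin G k := by
  have h20 := h.twenty_le_log
  have hn := h.log_lt
  have hrL : (r : ℝ) ≤ Real.log (Fintype.card V) := by
    have := h.nat_le_log hr
    push_cast at this
    linarith
  have hV : 4 ≤ Fintype.card V := by
    have : (4 : ℝ) ≤ Fintype.card V := by linarith
    exact_mod_cast this
  obtain ⟨a, ha⟩ := exists_guards (G := G) (R := r + 1) (Real.exp_pos 5).le
    (c := ballConst / 16) (by linarith [ballConst_pos]) hV hk0 hk (fun v => ball G r {v})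
    (fun v => by
      have := hG.card_ball_le h hrL {v}
      simp only [Finset.card_singleton, Nat.cast_one, one_mul] at this
      exact this.trans (mul_le_mul_of_nonneg_left hr0 (Real.exp_pos 5).le))
    (fun S hS => by
      have h1 := hG.min_le_card_ball_of_le h hr hD hS
      rw [← mul_assoc] at h1
      refine le_trans (mul_le_mul_of_nonneg_right ?_ ?_) h1
      · linarith [ballConst_pos]
      · exact le_min (by positivity) (by linarith))
  exact copsWin_of_guards_ball ha

/-- The case in which balls of some positive radius lie in the critical window. -/
lemma copsWin_of_window {r k₁ k₂ : ℕ} (hr1 : 1 ≤ r) (hk₁ : 0 < k₁) (hk₂ : 0 < k₂)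
    (hk₁' : 2 * (4 + Real.exp 5) / ballConst * √(Fintype.card V) ≤ k₁)
    (hk₂' : 2 * (4 + 2 * Real.exp 5) / (ballConst / 16) * √(Fintype.card V) ≤ k₂)
    (hr : (p * (Fintype.card V - 1)) ^ (r + 1) ≤ (Fintype.card V : ℝ))
    (hD : √(Fintype.card V) ≤ (p * (Fintype.card V - 1)) ^ (r + 1))
    (hD' : (p * (Fintype.card V - 1)) ^ (r + 1) < √(Fintype.card V) * Real.log (Fintype.card V)) :
    CopsWin G (k₁ + k₂) := by
  classical
  have h20 := h.twenty_le_log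
  have hn := h.log_lt
  have hd := h.log_le_deg
  have hd3 := h.le_deg
  have hL' := h.le_log
  have hexp := fun S (hS : S.Nonempty) => hG.min_le_card_ball_succ h hr hD (S := S) hS
  have hball : ∀ v, ((ball G r {v}).card : ℝ) ≤
      Real.exp 5 * (p * (Fintype.card V - 1)) ^ r := by
    intro v
    have := hG.card_ball_le h (r := r) (by
      have := h.nat_le_log hr
      push_cast at this
      linarith) {v}
    simpa using this
  have hV : 4 ≤ Fintype.card V := by
    have : (4 : ℝ) ≤ Fintype.card V := by linarith
    exact_mod_cast this
  have hne : Nonempty V := Fintype.card_pos_iff.1 (by omega)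
  have hball2 := fun T (hT : T.Nonempty) => hG.min_le_card_ball_of_le h hr le_rfl (S := T) hT
  have htwo := hG.card_closedNbr_le_two_mul h
  set n : ℝ := (Fintype.card V : ℝ) with hndef
  set L := Real.log n
  set d := p * (n - 1)
  have hd0 : 0 < d := by linarith
  have hsq : √n * √n = n := Real.mul_self_sqrt (by linarith)
  have hsq0 : 0 < √n := Real.sqrt_pos.2 (by linarith)
  have hdr : d ≤ d ^ r := le_self_pow₀ (by linarith) (by omega)
  -- d ≥ L³ against d^(r+1) < √n L puts d^r two logarithms below √n. With r ≥ 1 this gives √n/d > L,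
  -- enough for a union over n starting vertices.
  have hdr' : d ^ r * L ^ 2 ≤ √n := by
    have h1 : d ^ r * L ^ 3 ≤ d ^ (r + 1) := by
      rw [pow_succ]; exact mul_le_mul_of_nonneg_left hd3 (by positivity)
    have h2 : (d ^ r * L ^ 2) * L ≤ √n * L := by
      calc _ = d ^ r * L ^ 3 := by ring
        _ ≤ _ := h1.trans hD'.le
    exact le_of_mul_le_mul_right h2 (by linarith)
  have hK : L < √n / d := by
    rw [lt_div_iff₀ hd0]
    calc L * d ≤ L * d ^ r := mul_le_mul_of_nonneg_left hdr (by linarith)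
      _ < L ^ 2 * d ^ r := mul_lt_mul_of_pos_right (by nlinarith) (by positivity)
      _ = d ^ r * L ^ 2 := mul_comm _ _
      _ ≤ √n := hdr'
  -- With these values x K = d^r, so M x K is exactly the bound on the r-balls.
  obtain ⟨a₁, ha₁⟩ := exists_placement_up_to_deficiency (M := Real.exp 5) (k := k₁)
    (x := d ^ (r + 1) / √n) (K := √n / d) (by linarith [Real.add_one_le_exp 5])
    ballConst_pos (by rwa [le_div_iff₀ hsq0, one_mul]) (by positivity) hk₁'
    (fun v => ball G r {v}) (ball G (r + 1)) (fun v => by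
      refine (hball v).trans (le_of_eq ?_)
      field_simp
      ring)
    (fun v T hT => by
      rcases T.eq_empty_or_nonempty with rfl | hTne
      · simp
      refine le_trans (le_of_eq ?_) (hball2 T hTne)
      rw [min_eq_left, ← hndef]
      · field_simp
      · have hTc : (T.card : ℝ) ≤ Real.exp 5 * d ^ r :=
          le_trans (by exact_mod_cast Finset.card_le_card hT) (hball v)
        calc (T.card : ℝ) * d ^ (r + 1) ≤ (Real.exp 5 * d ^ r) * (√n * L) :=
              mul_le_mul hTc hD'.le (by positivity) (by positivity)
          _ ≤ (L * d ^ r) * (√n * L) := by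
              refine mul_le_mul_of_nonneg_right ?_ (by positivity)
              exact mul_le_mul_of_nonneg_right (by linarith [Real.exp_pos 5]) (by positivity)
          _ = (d ^ r * L ^ 2) * √n := by ring
          _ ≤ √n * √n := mul_le_mul_of_nonneg_right hdr' hsq0.le
          _ = n := hsq)
    (by
      rw [← hndef]
      calc n = Real.exp L := (Real.exp_log (by linarith : 0 < n)).symm
        _ < _ := Real.exp_lt_exp.2 hK)
  have hU := fun v => exists_guards_of_deficiency (G := G) (R := r + 1) (K := ⌊√n / d⌋₊) hk₁
    (a := a₁) (B := ball G r {v}) (fun T hT => by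
      have h1 := ha₁ v T hT
      have h2 : (T.card - (Finset.univ.filter fun i => a₁ i ∈ ball G (r + 1) T).card : ℕ) ≤
          ⌊√n / d⌋₊ := by
        apply Nat.le_floor
        rcases le_total (Finset.univ.filter fun i => a₁ i ∈ ball G (r + 1) T).card T.card
          with hle | hle
        · rw [Nat.cast_sub hle]; linarith
        · rw [Nat.sub_eq_zero_of_le hle]; simp only [Nat.cast_zero]; positivity
      have h3 : T.card ≤ (Finset.univ.filter fun i => a₁ i ∈ ball G (r + 1) T).card +
          ⌊√n / d⌋₊ := by omega
      convert h3)
  choose U W hUc hW hcov using hU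
  obtain ⟨a₂, ha₂⟩ := exists_guards (G := G) (R := r + 2) (Real.exp_pos 5).le
    (c := ballConst / 16) (by linarith [ballConst_pos]) hV hk₂ hk₂' (fun v => closedNbr G (U v))
    (fun v => by
      refine (htwo (U v)).trans ?_
      have h1 : ((U v).card : ℝ) ≤ √n / d :=
        le_trans (by exact_mod_cast hUc v) (Nat.floor_le (by positivity))
      rw [le_div_iff₀ hd0] at h1
      have h2 := Real.add_one_le_exp 5
      rw [← hndef]
      nlinarith)
    hexp
  exact copsWin_of_two_teams U (fun v => ⟨W v, hW v, hcov v⟩) ha₂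

set_option maxHeartbeats 1000000 in
/-- The case in which neighbourhoods lie in the critical window. -/
lemma copsWin_of_degree_window {k₁ k₂ : ℕ} (hk₂ : 0 < k₂)
    (hk₁' : 2 * (4 + Real.exp 5) / ballConst * √(Fintype.card V) ≤ k₁)
    (hk₂' : 2 * (4 + 2 * Real.exp 5) / (ballConst / 16) * √(Fintype.card V) ≤ k₂)
    (hD : √(Fintype.card V) ≤ p * (Fintype.card V - 1))
    (hD' : p * (Fintype.card V - 1) < √(Fintype.card V) * Real.log (Fintype.card V)) :
    CopsWin G (k₁ + k₂) := by
  classical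
  have h20 := h.twenty_le_log
  have hn := h.log_lt
  have hd := h.log_le_deg
  have hdn := h.deg_le
  have hpow := h.log_pow_le
  have hr : (p * ((Fintype.card V : ℝ) - 1)) ^ (0 + 1) ≤ (Fintype.card V : ℝ) := by
    rw [zero_add, pow_one]; linarith
  have hexp := fun S (hS : S.Nonempty) =>
    hG.min_le_card_ball_succ h hr (by simpa using hD) (S := S) hS
  have hV : 4 ≤ Fintype.card V := by
    have : (4 : ℝ) ≤ Fintype.card V := by linarith
    exact_mod_cast this
  have hne : Nonempty V := Fintype.card_pos_iff.1 (by omega)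
  have hball2 := fun T (hT : T.Nonempty) => hG.min_le_card_ball_of_le h hr le_rfl (S := T) hT
  simp only [zero_add, pow_one] at hball2
  have htwo := fun v => hG.card_closedNbr_le_two_mul h {v}
  simp only [Finset.card_singleton, Nat.cast_one, mul_one] at htwo
  set n : ℝ := (Fintype.card V : ℝ) with hndef
  set L := Real.log n with hLdef
  set d := p * (n - 1)
  have hn0 : 0 < n := by linarith
  have hd0 : 0 < d := by linarith
  have hsq : √n * √n = n := Real.mul_self_sqrt hn0.le
  have hsq0 : 0 < √n := Real.sqrt_pos.2 hn0
  have he : 6 ≤ Real.exp 5 := by linarith [Real.add_one_le_exp (5 : ℝ)]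
  set M := Real.exp 5 with hMdef
  set x := d / √n with hxdef
  have hx1 : 1 ≤ x := by rwa [hxdef, le_div_iff₀ hsq0, one_mul]
  have hxL : x < L := by rwa [hxdef, div_lt_iff₀ hsq0, mul_comm]
  have hdx : d = x * √n := by rw [hxdef]; field_simp
  have hnd : n / d = √n / x := by
    rw [div_eq_div_iff hd0.ne' (by linarith), hdx]
    linear_combination (-x) * hsq
  -- A subset T of a block of at most n/d vertices has |T| d ≤ n, so its expansion is not saturated.
  set b := ⌊n / d⌋₊ with hbdef
  have hb1 : 1 ≤ b := by
    rw [hbdef, Nat.one_le_floor_iff, le_div_iff₀ hd0]; linarith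
  have hb : (b : ℝ) ≤ n / d := Nat.floor_le (by positivity)
  have hb' : n / d / 2 ≤ b := by
    have h1 := Nat.lt_floor_add_one (n / d)
    have h2 : (1 : ℝ) ≤ b := by exact_mod_cast hb1
    rw [← hbdef] at h1
    linarith
  -- Since b ≥ n/(2d) and d = x√n, this many blocks cover a closed neighbourhood of at most 2d
  -- vertices.
  set m := ⌈4 * x ^ 2⌉₊ with hmdef
  have hm : 4 * x ^ 2 ≤ m := Nat.le_ceil _
  have hm' : (m : ℝ) ≤ 5 * x ^ 2 := by
    have := Nat.ceil_lt_add_one (a := 4 * x ^ 2) (by positivity)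
    nlinarith
  have hblocks : ∀ v, (closedNbr G {v}).card ≤ m * b := by
    intro v
    have h1 : ((closedNbr G {v}).card : ℝ) ≤ m * b := by
      refine (htwo v).trans ?_
      calc 2 * d = 4 * x ^ 2 * (n / d / 2) := by
            rw [hnd, hdx]; field_simp; ring
        _ ≤ m * b := mul_le_mul hm hb' (by positivity) (by positivity)
    exact_mod_cast h1
  choose B hB hBcov using fun v => exists_cover_of_card_le b m _ (hblocks v)
  -- Chosen so that M x K = n/d, the bound on the block size.
  set K := √n / (M * x ^ 2) with hKdef
  have hK : L ^ 3 ≤ K := by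
    rw [hKdef, le_div_iff₀ (by positivity)]
    -- The square root of `IsDense.log_pow_le`.
    have h1 : M * L ^ 5 ≤ √n := by
      apply Real.le_sqrt_of_sq_le
      refine le_trans (le_of_eq ?_) hpow
      have : Real.exp 10 = M ^ 2 := by rw [hMdef, ← Real.exp_nat_mul]; norm_num
      rw [this]; ring
    have h2 : x ^ 2 ≤ L ^ 2 := pow_le_pow_left₀ (by linarith) hxL.le 2
    calc L ^ 3 * (M * x ^ 2) ≤ L ^ 3 * (M * L ^ 2) := by gcongr
      _ = M * L ^ 5 := by ring
      _ ≤ _ := h1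
  have h2 : 5 * L ^ 2 < n ^ 2 := by
    have h3 : L ^ 2 * 20 ≤ L ^ 3 := by
      rw [pow_succ L 2]; exact mul_le_mul_of_nonneg_left h20 (by positivity)
    have h4 : L ^ 3 ≤ d := h.le_deg
    have h5 : n * 1 < n * n := mul_lt_mul_of_pos_left (by linarith) hn0
    have h6 : 0 ≤ L ^ 2 := sq_nonneg L
    rw [sq n]
    linarith
  obtain ⟨a₁, ha₁⟩ := exists_placement_up_to_deficiency (M := M) (k := k₁)
    (x := x) (K := K) (by linarith) ballConst_pos hx1 (by positivity) hk₁'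
    (fun j : V × Fin m => B j.1 j.2) (ball G 1) (fun j => by
      refine le_trans (by exact_mod_cast hB j.1 j.2) (hb.trans (le_of_eq ?_))
      rw [hKdef, hnd]
      field_simp)
    (fun j T hT => by
      rcases T.eq_empty_or_nonempty with rfl | hTne
      · simp
      refine le_trans (le_of_eq ?_) (hball2 T hTne)
      rw [min_eq_left, ← hndef, hdx]
      · ring
      · rw [← le_div_iff₀ hd0]
        refine le_trans ?_ hb
        exact_mod_cast (Finset.card_le_card hT).trans (hB j.1 j.2))
    (by
      rw [Fintype.card_prod, Fintype.card_fin, Nat.cast_mul, ← hndef]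
      have h1 : (m : ℝ) ≤ 5 * L ^ 2 :=
        hm'.trans (by nlinarith [pow_le_pow_left₀ (by linarith) hxL.le 2])
      calc n * m ≤ n * (5 * L ^ 2) := mul_le_mul_of_nonneg_left h1 hn0.le
        _ < n * n ^ 2 := mul_lt_mul_of_pos_left h2 hn0
        _ = Real.exp (3 * L) := by
          rw [show 3 * L = ((3 : ℕ) : ℝ) * L by norm_num, Real.exp_nat_mul, hLdef,
            Real.exp_log hn0]
          ring
        _ ≤ Real.exp K := by
          apply Real.exp_le_exp.2
          refine le_trans ?_ hK
          rw [pow_succ L 2]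
          exact mul_le_mul_of_nonneg_right (by nlinarith) (by linarith))
  let Z : V → Finset V := fun v =>
    (closedNbr G {v}).filter fun u => ∀ i, a₁ i ∉ closedNbr G {u}
  have hZ : ∀ v, ((Z v).card : ℝ) ≤ M * √n := by
    intro v
    -- No first-team cop is within distance 1 of `Z v`, so the deficiency alone bounds each piece.
    have hpiece : ∀ j : Fin m, ((Z v ∩ B v j).card : ℝ) ≤ K := by
      intro j
      have h1 := ha₁ (v, j) (Z v ∩ B v j) Finset.inter_subset_right
      have h2 : (Finset.univ.filter fun i => a₁ i ∈ ball G 1 (Z v ∩ B v j)) = ∅ := by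
        refine Finset.filter_eq_empty_iff.2 fun i _ hi => ?_
        obtain ⟨u, hu, hui⟩ := mem_ball_iff_exists.1 hi
        exact (Finset.mem_filter.1 (Finset.mem_inter.1 hu).1).2 i hui
      have h3 : (Finset.univ.filter fun i => a₁ i ∈ ball G 1 (Z v ∩ B v j)).card = 0 := by
        rw [h2]; rfl
      have h4 : ((Z v ∩ B v j).card : ℝ) ≤ ((0 : ℕ) : ℝ) + K := by
        rw [← h3]; convert h1
      simpa using h4
    have hsub : Z v ⊆ Finset.univ.biUnion fun j : Fin m => Z v ∩ B v j := by
      intro u hu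
      obtain ⟨j, hj, huj⟩ := hBcov v u (Finset.mem_filter.1 hu).1
      exact Finset.mem_biUnion.2 ⟨⟨j, hj⟩, Finset.mem_univ _, Finset.mem_inter.2 ⟨hu, huj⟩⟩
    calc ((Z v).card : ℝ) ≤ ∑ j : Fin m, ((Z v ∩ B v j).card : ℝ) := by
          exact_mod_cast (Finset.card_le_card hsub).trans Finset.card_biUnion_le
      _ ≤ ∑ _j : Fin m, K := Finset.sum_le_sum fun j _ => hpiece j
      _ = m * K := by simp
      _ ≤ 5 * x ^ 2 * K := mul_le_mul_of_nonneg_right hm' (by positivity)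
      _ = 5 / M * √n := by rw [hKdef]; field_simp
      _ ≤ M * √n := by
          refine mul_le_mul_of_nonneg_right ?_ hsq0.le
          rw [div_le_iff₀ (by linarith)]
          nlinarith
  obtain ⟨a₂, ha₂⟩ := exists_guards (G := G) (R := 2) (by linarith : 0 ≤ M)
    (c := ballConst / 16) (by linarith [ballConst_pos]) hV hk₂ hk₂' Z hZ hexp
  refine copsWin_of_waiting_team (a₁ := a₁) Z (fun v u hu huZ => ?_) ha₂
  by_contra hcon
  push Not at hcon
  exact huZ (Finset.mem_filter.2 ⟨hu, hcon⟩)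

/-- Meyniel's bound for expanding graphs in the dense range. -/
theorem copNumber_le_mul_sqrt :
    (copNumber G : ℝ) ≤ (2 * (4 + Real.exp 5) / ballConst +
      2 * (4 + 2 * Real.exp 5) / (ballConst / 16) + 2) * √(Fintype.card V) := by
  have h20 := h.twenty_le_log
  have hn := h.log_lt
  have hd := h.log_le_deg
  have hdn := h.deg_le
  have hc := ballConst_pos
  set C₁ := 2 * (4 + Real.exp 5) / ballConst
  set C₂ := 2 * (4 + 2 * Real.exp 5) / (ballConst / 16)
  have hC₁ : 0 < C₁ := by positivity
  have hC₂ : 0 < C₂ := by positivity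
  set n : ℝ := (Fintype.card V : ℝ) with hndef
  set L := Real.log n with hLdef
  set d := p * (n - 1) with hddef
  have hsq1 : 1 ≤ √n := Real.one_le_sqrt.2 (by linarith)
  have hsq : √n * √n = n := Real.mul_self_sqrt (by linarith)
  have hk₁ : C₁ * √n ≤ ⌈C₁ * √n⌉₊ := Nat.le_ceil _
  have hk₂ : C₂ * √n ≤ ⌈C₂ * √n⌉₊ := Nat.le_ceil _
  have hk₁0 : 0 < ⌈C₁ * √n⌉₊ := Nat.ceil_pos.2 (by positivity)
  have hk₂0 : 0 < ⌈C₂ * √n⌉₊ := Nat.ceil_pos.2 (by positivity)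
  have hk₁' := Nat.ceil_lt_add_one (a := C₁ * √n) (by positivity)
  have hk₂' := Nat.ceil_lt_add_one (a := C₂ * √n) (by positivity)
  -- The two roundings cost less than 2 ≤ 2√n, whence the + 2 in the constant.
  suffices hmain : copNumber G ≤ ⌈C₁ * √n⌉₊ + ⌈C₂ * √n⌉₊ by
    have : (copNumber G : ℝ) ≤ ⌈C₁ * √n⌉₊ + ⌈C₂ * √n⌉₊ := by exact_mod_cast hmain
    nlinarith
  have hex : ∃ r : ℕ, √n < d ^ (r + 1) := by
    obtain ⟨r, hr⟩ := pow_unbounded_of_one_lt √n (by linarith : 1 < d)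
    exact ⟨r, hr.trans_le (pow_le_pow_right₀ (by linarith) (Nat.le_succ r))⟩
  classical
  -- The least such r; for r = 0 the second inequality is 1 ≤ √n.
  obtain ⟨r, hr, hrmin⟩ : ∃ r : ℕ, √n < d ^ (r + 1) ∧ d ^ r ≤ √n := by
    refine ⟨Nat.find hex, Nat.find_spec hex, ?_⟩
    rcases hf : Nat.find hex with _ | r
    · simpa using hsq1
    · exact not_lt.1 (Nat.find_min hex (by omega : r < Nat.find hex))
  have hrn : d ^ (r + 1) ≤ n := by
    rcases Nat.eq_zero_or_pos r with rfl | hr1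
    · rw [zero_add, pow_one]; linarith
    · have : d ≤ d ^ r := le_self_pow₀ (by linarith) (by omega)
      rw [pow_succ, ← hsq]
      exact mul_le_mul hrmin (this.trans hrmin) (by linarith) (by linarith)
  rcases le_or_gt (√n * L) (d ^ (r + 1)) with hgap | hgap
  · exact (copNumber_le hk₂0 (hG.copsWin_of_gap h hk₂0 hk₂ hrmin hrn hgap)).trans
      (Nat.le_add_left _ _)
  · apply copNumber_le (by omega)
    rcases Nat.eq_zero_or_pos r with rfl | hr1
    · rw [zero_add, pow_one] at hr hgap
      exact hG.copsWin_of_degree_window h hk₂0 hk₁ hk₂ hr.le hgap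
    · exact hG.copsWin_of_window h hr1 hk₁0 hk₂0 hk₁ hk₂ hrn hr.le hgap

end IsExpanding

end CopNumber

/-! ### Passage to the limit -/

section Asymptotics

open MeasureTheory

lemma eventually_isDense {p : ℕ → unitInterval}
    (hp : ∀ᶠ n : ℕ in atTop, Real.log (n : ℝ) ^ 3 ≤ (p n : ℝ) * ((n : ℝ) - 1)) :
    ∀ᶠ n : ℕ in atTop, IsDense n (p n) := by
  have h1 : ∀ᶠ n : ℕ in atTop, 2 * (5 + 2 * Real.exp 5) ≤ Real.log (n : ℝ) :=
    (Real.tendsto_log_atTop.comp tendsto_natCast_atTop_atTop).eventually_ge_atTop _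
  have h2 : ∀ᶠ n : ℕ in atTop, Real.exp 10 * Real.log (n : ℝ) ^ 10 ≤ n := by
    have h3 := ((Real.isLittleO_pow_log_id_atTop (n := 10)).bound
      (inv_pos.2 (Real.exp_pos 10)))
    filter_upwards [tendsto_natCast_atTop_atTop.eventually h3, h1] with n hn hlog
    have hpos : 0 ≤ Real.log (n : ℝ) := le_trans (by positivity) hlog
    rw [Real.norm_of_nonneg (by positivity), id, Real.norm_of_nonneg (by positivity),
      inv_mul_eq_div, le_div_iff₀ (Real.exp_pos 10)] at hn
    linarith
  filter_upwards [hp, h1, h2] with n hn hn1 hn2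
  exact ⟨(p n).2.1, (p n).2.2, hn1, hn, hn2⟩

lemma one_sub_le_measure_copNumber_le {n : ℕ} {p : unitInterval} (h : IsDense n p) :
    1 - ENNReal.ofReal (3 / n) ≤ SimpleGraph.binomialRandom (Fin n) p
      {G : SimpleGraph (Fin n) | (copNumber G : ℝ) ≤
        (2 * (4 + Real.exp 5) / ballConst + 2 * (4 + 2 * Real.exp 5) / (ballConst / 16) + 2) *
          √n} := by
  set A := {G : SimpleGraph (Fin n) | (copNumber G : ℝ) ≤
        (2 * (4 + Real.exp 5) / ballConst + 2 * (4 + 2 * Real.exp 5) / (ballConst / 16) + 2) *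
          √n} with hA
  have h' : IsDense (Fintype.card (Fin n)) p := by simpa using h
  have hsub : Aᶜ ⊆ {G | ¬ IsExpanding G p} := by
    intro G hG hexp
    apply hG
    have := hexp.copNumber_le_mul_sqrt h'
    rwa [Fintype.card_fin] at this
  have hle : SimpleGraph.binomialRandom (Fin n) p Aᶜ ≤ ENNReal.ofReal (3 / n) := by
    refine (measure_mono hsub).trans ?_
    have := measureReal_not_isExpanding_le h'
    rw [Fintype.card_fin] at this
    rw [← ofReal_measureReal]
    exact ENNReal.ofReal_le_ofReal this
  rw [tsub_le_iff_right]
  -- Subadditivity suffices, so measurability of `A` plays no role.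
  calc 1 = SimpleGraph.binomialRandom (Fin n) p (A ∪ Aᶜ) := by simp
    _ ≤ _ := (measure_union_le _ _).trans (add_le_add le_rfl hle)

end Asymptotics
end CopsAndRobbers

theorem theorem2p4 :
    ∃ C : ℝ, 0 < C ∧
      ∀ p : ℕ → unitInterval,
        (∀ᶠ n : ℕ in atTop, Real.log (n : ℝ) ^ 3 ≤ (p n : ℝ) * ((n : ℝ) - 1)) →
        Tendsto
          (fun n : ℕ => SimpleGraph.binomialRandom (Fin n) (p n)
            {G : SimpleGraph (Fin n) |
              (CopsAndRobbers.copNumber G : ℝ) ≤ C * Real.sqrt (n : ℝ)})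
          atTop (𝓝 1) := by
  have hc := CopsAndRobbers.ballConst_pos
  -- The constant is read off by unification with `one_sub_le_measure_copNumber_le`; the probability
  -- is squeezed between 1 - 3/n and 1.
  refine ⟨_, by positivity, fun p hp => tendsto_of_tendsto_of_tendsto_of_le_of_le'
    (g := fun n : ℕ => 1 - ENNReal.ofReal (3 / n)) ?_ tendsto_const_nhds
    ((CopsAndRobbers.eventually_isDense hp).mono fun n hn =>
      CopsAndRobbers.one_sub_le_measure_copNumber_le hn)
    (.of_forall fun n => MeasureTheory.prob_le_one)⟩
  have h1 : Tendsto (fun n : ℕ => ENNReal.ofReal (3 / n)) atTop (𝓝 0) := by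
    rw [← ENNReal.ofReal_zero]
    exact ENNReal.tendsto_ofReal (tendsto_const_div_atTop_nhds_zero_nat 3)
  simpa using ENNReal.Tendsto.sub tendsto_const_nhds h1 (Or.inl ENNReal.one_ne_top)
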